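/- **Setting.** Let $C\ge 2$, let $\mathcal X$ be a measurable space and $P$ a probability measure on $\mathcal X\times\{1,\dots,C\}$ with uniform class distribution $p(i)=P(y=i)=1/C$. Classifiers are pairs $\theta=(M,w)$ in a hypothesis class $\mathcal H$, where $M=[M_1,\dots,M_C]\in\mathbb R^{d\times C}$ and $f(\cdot;w):\mathcal X\to\mathbb R^d$ is a feature extractor; the logits are $\langle M_c,f(x;w)\rangle$. Let $\mathcal F=\{(M_i-M_j)^Tf(\cdot;w)\;:\;i\ne j,\ (M,w)\in\mathcal H\}$, assumed pointwise measurable (its members are measurable, and some countable subclass has every member as a pointwise limit of a sequence). Let $\mathcal M_i\subset\mathcal X$ be sets that carry the classes ($x\in\mathcal M_y$ for $P$-almost every $(x,y)$), and suppose $$\sup_{i\ne j}\ \sup_{(M,w)\in\mathcal H}\ \sup_{x\in\mathcal M_i}\bigl|(M_i-M_j)^Tf(x;w)\bigr|\le K .$$ Write $$\mathfrak R_n(\mathcal F)=\max_{1\le i\le C}\ \mathbb E_{x_1,\dots,x_n\sim P(x\mid y=i)}\ \mathbb E_\sigma\ \sup_{g\in\mathcal F}\Bigl|\frac1n\sum_{k=1}^n\sigma_k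 g(x_k)\Bigr|\in[0,\infty]$$ with i.i.d. samples and independent uniform signs $\sigma_k$. Let $S=\{(x_k,y_k)\}_{k=1}^N$ be drawn i.i.d. from $P$, with $N\ge1$ and $C\mid N$; let $S_i$ be its samples of class $i$ and $N_i=|S_i|$. Call $S$ balanced if $N_i=N/C$ for all $i$. Let $\delta\in(0,1)$. A margin family is $\gamma=\{\gamma_{ij}\}_{i\ne j}$ with all $\gamma_{ij}>0$. For $\gamma>2K$, $\sqrt{\log\log_2(4K/\gamma)}$ is read as $0$. **(1) Balanced bound.** Conditionally on $S$ being balanced, with probability at least $1-\delta$ over $S$, simultaneously for all $(M,w)\in\mathcal H$ and all margin families $\gamma$, $$\mathbb P_{x,y}\Bigl(\arg\max_c\,\langle M_c,f(x;w)\rangle\neq y\Bigr)\le \frac{4\,\mathfrak R_{N/C}(\mathcal F)}{C}\sum_{i=1}^C\sum_{j\ne i}\frac1{\gamma_{ij}}+\frac1{\sqrt{NC}}\sum_{i=1}^C\sum_{j\ne i}\sqrt{\log\Bigl(\log_2\frac{4K}{\gamma_{ij}}\Bigr)}+L_{0,1}+(C-1)\sqrt{\frac{C\log\bigl(C(C-1)/\delta\bigr)}{2N}},$$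 where a tie for the maximum counts as an error and $$L_{0,1}=\sum_{i=1}^C p(i)\sum_{j\ne i}\ \sum_{x\in S_i}\frac{\mathbb I\bigl((M_i-M_j)^Tf(x;w)\le\gamma_{ij}\bigr)}{N_i},\qquad p(i)=\frac1C,\quad N_i=\frac NC .$$ **(2) Reduction.** For every balanced $S$, every $(M,w)\in\mathcal H$ and every margin family, this right-hand side equals the multiclass margin bound $$\sum_i p(i)\sum_{j\ne i}\frac{4\,\mathfrak R_{N_i}(\mathcal F)}{\gamma_{ij}}+\sum_i p(i)\sum_{j\ne i}\sqrt{\frac{\log(\log_2\frac{4K}{\gamma_{ij}})}{N_i}}+L_{0,1}+\sum_i p(i)\sum_{j\ne i}\sqrt{\frac{\log(C(C-1)/\delta)}{2N_i}} .$$ **(3) Minimal margin.** For every margin family, $$\sum_{i=1}^C\sum_{j\ne i}\frac1{\gamma_{ij}}\le C(C-1)\max_{i\ne j}\frac1{\gamma_{ij}},\qquad \max_{i\ne j}\frac1{\gamma_{ij}}=\frac1{\min_{i\ne j}\gamma_{ij}} .$$ **(4) Minimisation.** For every nonempty set $\Gamma$ of margin families, $$\frac1{C(C-1)}\inf_{\gamma\in\Gamma}\sum_{i=1}^C\sum_{j\ne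 i}\frac1{\gamma_{ij}}\le\inf_{\gamma\in\Gamma}\max_{i\ne j}\frac1{\gamma_{ij}},$$ and an element of $\Gamma$ minimises $\max_{i\ne j}1/\gamma_{ij}$ over $\Gamma$ if and only if it maximises $\min_{i\ne j}\gamma_{ij}$ over $\Gamma$. -/

import Mathlib

open MeasureTheory ProbabilityTheory Filter Topology
open scoped ENNReal

noncomputable section

/-- A class of real functions is pointwise measurable if its members are measurable and it has a
countable subclass from which every member is obtained as a pointwise limit of a sequence. This is
the usual convention that makes suprema over the class measurable. -/
def PointwiseMeasurable {X : Type*} [MeasurableSpace X] (F : Set (X → ℝ)) : Prop :=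
  (∀ g ∈ F, Measurable g) ∧
    ∃ F₀ ⊆ F, F₀.Countable ∧
      ∀ g ∈ F, ∃ u : ℕ → X → ℝ, (∀ m, u m ∈ F₀) ∧
        ∀ x, Tendsto (fun m => u m x) atTop (𝓝 (g x))

/-- Rademacher complexity `E_x E_σ sup_{g ∈ F} |n⁻¹ ∑ₖ σₖ g(xₖ)|`, where `x₁, …, xₙ` are i.i.d.
with law `D` and `σ` is uniform on `{-1, 1}ⁿ`. It may be infinite. For a class with `F = -F`,
such as the margin class below, the absolute value makes no difference. -/
def rademacherComplexity {X : Type*} [MeasurableSpace X] (F : Set (X → ℝ)) (D : Measure X)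
    (n : ℕ) : ℝ≥0∞ :=
  ∫⁻ x : Fin n → X,
    ((2 : ℝ≥0∞) ^ n)⁻¹ * ∑ σ : Fin n → ℤˣ,
      ⨆ g ∈ F, ENNReal.ofReal |(1 / (n : ℝ)) * ∑ k, ((σ k : ℤ) : ℝ) * g (x k)|
    ∂(Measure.pi fun _ => D)

/-- A classifier: the columns `M₁, …, M_C ∈ ℝᵈ` of the last layer and the parameter `w` of the
feature extractor. -/
abbrev Classifier (C d : ℕ) (W : Type*) : Type _ := (Fin C → EuclideanSpace ℝ (Fin d)) × W

/-- The `c`-th logit `⟨M_c, f(x; w)⟩`. -/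
def logit {X W : Type*} {C d : ℕ} (f : W → X → EuclideanSpace ℝ (Fin d))
    (θ : Classifier C d W) (c : Fin C) (x : X) : ℝ :=
  inner ℝ (θ.1 c) (f θ.2 x)

/-- The margin `(M_i - M_j)ᵀ f(x; w)` between the classes `i` and `j`. -/
def margin {X W : Type*} {C d : ℕ} (f : W → X → EuclideanSpace ℝ (Fin d))
    (θ : Classifier C d W) (i j : Fin C) (x : X) : ℝ :=
  inner ℝ (θ.1 i - θ.1 j) (f θ.2 x)

/-- The class `{(M_i - M_j)ᵀ f(·; w) | i ≠ j, (M, w) ∈ H}`. -/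
def marginClass {X W : Type*} {C d : ℕ} (f : W → X → EuclideanSpace ℝ (Fin d))
    (H : Set (Classifier C d W)) : Set (X → ℝ) :=
  {g | ∃ θ ∈ H, ∃ i j : Fin C, i ≠ j ∧ g = margin f θ i j}

/-- The event that the true label is not the unique maximiser of the logits (so a tie counts as
an error, whatever rule is used to break it). -/
def errorEvent {X W : Type*} {C d : ℕ} (f : W → X → EuclideanSpace ℝ (Fin d))
    (θ : Classifier C d W) : Set (X × Fin C) :=
  {z | ∃ j, j ≠ z.2 ∧ logit f θ z.2 z.1 ≤ logit f θ j z.1}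

/-- The proportion `p(i)` of class `i`. -/
def classProb {X : Type*} [MeasurableSpace X] {C : ℕ} (P : Measure (X × Fin C)) (i : Fin C) : ℝ :=
  P.real {z | z.2 = i}

/-- The conditional law of `x` given `y = i`. -/
def classCond {X : Type*} [MeasurableSpace X] {C : ℕ} (P : Measure (X × Fin C)) (i : Fin C) :
    Measure X :=
  (P[|{z : X × Fin C | z.2 = i}]).map Prod.fst

/-- The complexity `Rₙ(F)` for samples from a single class: the largest, over the classes `i`, of the Rademacher
complexities of `F` for `n` samples from the law of `x` given `y = i`. -/
def classRademacher {X : Type*} [MeasurableSpace X] {C : ℕ} (F : Set (X → ℝ))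
    (P : Measure (X × Fin C)) (n : ℕ) : ℝ≥0∞ :=
  ⨆ i : Fin C, rademacherComplexity F (classCond P i) n

/-- The number `N_i` of samples of class `i` in the training set `S`. -/
def classCount {X : Type*} {C N : ℕ} (S : Fin N → X × Fin C) (i : Fin C) : ℕ :=
  (Finset.univ.filter fun k => (S k).2 = i).card

/-- `N_i = N / C` for every class `i`. -/
def IsBalanced {X : Type*} {C N : ℕ} (S : Fin N → X × Fin C) : Prop :=
  ∀ i, (classCount S i : ℝ) = (N : ℝ) / C

/-- Equal to `log (log₂ (4K/γ))` for `0 < γ ≤ 2K`. For `γ > 2K`, where that expression is negative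
or undefined, the value is `0`. -/
def logLogTerm (K γ : ℝ) : ℝ :=
  Real.log (max 1 (Real.logb 2 (4 * K / γ)))

open Classical in
/-- The empirical risk term
`L₀₁ = ∑_i p(i) ∑_{j ≠ i} ∑_{x ∈ S_i} 𝟙((M_i - M_j)ᵀ f(x; w) ≤ γ_{ij}) / N_i`. -/
def empiricalRisk {X W : Type*} {C d N : ℕ} (p : Fin C → ℝ)
    (f : W → X → EuclideanSpace ℝ (Fin d)) (S : Fin N → X × Fin C)
    (θ : Classifier C d W) (γ : Fin C → Fin C → ℝ) : ℝ :=
  ∑ i, p i * ∑ j ∈ Finset.univ.erase i,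
    ∑ k ∈ Finset.univ.filter (fun k => (S k).2 = i),
      (if margin f θ i j (S k).1 ≤ γ i j then (1 : ℝ) else 0) / classCount S i

/-- The right-hand side of the multiclass margin bound, for arbitrary class proportions `p(i)` and
class sizes `N_i`, with its confidence term. -/
def multiclassMarginBound {X W : Type*} [MeasurableSpace X] {C d N : ℕ} (P : Measure (X × Fin C))
    (f : W → X → EuclideanSpace ℝ (Fin d)) (H : Set (Classifier C d W)) (K δ : ℝ)
    (S : Fin N → X × Fin C) (θ : Classifier C d W) (γ : Fin C → Fin C → ℝ) : ℝ≥0∞ :=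
  ∑ i, ENNReal.ofReal (classProb P i) * ∑ j ∈ Finset.univ.erase i,
      4 * classRademacher (marginClass f H) P (classCount S i) / ENNReal.ofReal (γ i j)
  + ENNReal.ofReal
      (∑ i, classProb P i * ∑ j ∈ Finset.univ.erase i,
        Real.sqrt (logLogTerm K (γ i j) / classCount S i))
  + ENNReal.ofReal (empiricalRisk (classProb P) f S θ γ)
  + ENNReal.ofReal
      (∑ i, classProb P i * ∑ _j ∈ Finset.univ.erase i,
        Real.sqrt (Real.log ((C : ℝ) * (C - 1) / δ) / (2 * classCount S i)))

/-- The right-hand side of the bound in the balanced case `p(i) = 1/C`, `N_i = N/C`. -/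
def balancedMarginBound {X W : Type*} [MeasurableSpace X] {C d N : ℕ} (P : Measure (X × Fin C))
    (f : W → X → EuclideanSpace ℝ (Fin d)) (H : Set (Classifier C d W)) (K δ : ℝ)
    (S : Fin N → X × Fin C) (θ : Classifier C d W) (γ : Fin C → Fin C → ℝ) : ℝ≥0∞ :=
  4 * classRademacher (marginClass f H) P (N / C) / C *
      ENNReal.ofReal (∑ i, ∑ j ∈ Finset.univ.erase i, 1 / γ i j)
  + ENNReal.ofReal
      (1 / Real.sqrt ((N : ℝ) * C) *
        ∑ i, ∑ j ∈ Finset.univ.erase i, Real.sqrt (logLogTerm K (γ i j)))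
  + ENNReal.ofReal (empiricalRisk (fun _ => 1 / (C : ℝ)) f S θ γ)
  + ENNReal.ofReal
      (((C : ℝ) - 1) * Real.sqrt ((C : ℝ) * Real.log ((C : ℝ) * (C - 1) / δ) / (2 * N)))

/-- A family of margins `γ_{ij} > 0`, `i ≠ j`; the diagonal entries play no role. -/
def IsMarginFamily {C : ℕ} (γ : Fin C → Fin C → ℝ) : Prop :=
  ∀ i j, i ≠ j → 0 < γ i j

/-- `∑_{i ≠ j} 1 / γ_{ij}`. -/
def sumInvMargin {C : ℕ} (γ : Fin C → Fin C → ℝ) : ℝ :=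
  ∑ i, ∑ j ∈ Finset.univ.erase i, 1 / γ i j

/-- `max_{i ≠ j} 1 / γ_{ij}`. -/
def maxInvMargin {C : ℕ} (γ : Fin C → Fin C → ℝ) : ℝ :=
  ⨆ q : {q : Fin C × Fin C // q.1 ≠ q.2}, 1 / γ q.1.1 q.1.2

/-- `min_{i ≠ j} γ_{ij}`. -/
def minMargin {C : ℕ} (γ : Fin C → Fin C → ℝ) : ℝ :=
  ⨅ q : {q : Fin C × Fin C // q.1 ≠ q.2}, γ q.1.1 q.1.2

end

/-! Given the labels, the inputs of class `i` are `n = N/C` i.i.d. draws from `classCond P i`, so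
the probabilistic claim reduces to one margin bound per class. The error event is covered by the
events that the label is `i` and the margin of `i` against some `j` is nonpositive; summing the
class bounds with weights `p(i)` gives the multiclass bound.

For one class and a fixed scale `a`, the ramp of slope `1/a` lies above the indicator of `g ≤ 0` and
below that of `g ≤ a`. The worst deviation between its mean and its sample average concentrates by
McDiarmid (`measure_add_le_of_bounded_differences`). Its expectation is at most `(2/a) R`, by
symmetrisation (`integral_iSup_deviation_le`) and contraction
(`sum_iSup_rademacher_le_of_contraction`). Suprema are taken over finite families; pointwise limits
then reach the whole class.

To allow every `γ < K` at once, a union bound runs over the scales `K/2^(k+1)` with weights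
`1/(k+2)²`. Rounding `γ` down to a scale loses at most a factor `2`, whence the constant `4`, and
the weights cost the `log log₂` term (`PointwiseMeasurable.measure_margin_bound_fails_le`). For `γ ≥
K` the empirical term of the pair is already `1`.

The reduction is the computation with `p(i) = 1/C`, `N_i = N/C`. The claims on minimal margins hold
because inversion reverses the order of positive numbers. -/

/-! ### McDiarmid's inequality. -/

/-- McDiarmid's inequality in exponential form: a function of `n` independent variables whose value
increases by at most `c` when a single variable is changed is sub-Gaussian. -/
theorem integral_exp_le_of_bounded_differences {X : Type*} [MeasurableSpace X] (D : Measure X)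
    [IsProbabilityMeasure D] {c : ℝ} (hc : 0 ≤ c) (B t : ℝ) :
    ∀ (n : ℕ) (f : (Fin n → X) → ℝ), Measurable f → (∀ x, |f x| ≤ B) →
      (∀ x k y, f (Function.update x k y) ≤ f x + c) →
      ∫ x, Real.exp (t * (f x - ∫ x', f x' ∂Measure.pi fun _ => D)) ∂Measure.pi (fun _ => D) ≤
        Real.exp (n * (c / 2) ^ 2 * t ^ 2 / 2) := by
  intro n
  induction n with
  | zero =>
    intro f _ _ _
    have h : ∀ x, f x = f default := fun x => by rw [Subsingleton.elim x default]
    simp [h]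
  | succ n ih =>
    intro f hf hB hd
    set e := MeasurableEquiv.piFinSuccAbove (fun _ : Fin (n + 1) => X) 0 with he
    have hmp : MeasurePreserving e (Measure.pi fun _ => D) (D.prod (Measure.pi fun _ => D)) :=
      measurePreserving_piFinSuccAbove (fun _ => D) 0
    have hsymm : ∀ a y, e.symm (a, y) = Fin.cons a y := fun a y => by
      simp [he, MeasurableEquiv.piFinSuccAbove, Fin.insertNthEquiv]
    have htr : ∀ G : (Fin (n + 1) → X) → ℝ, ∫ x, G x ∂(Measure.pi fun _ => D) =
        ∫ p, G (e.symm p) ∂(D.prod (Measure.pi fun _ => D)) := fun G => by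
      rw [← hmp.symm.integral_comp']
    set F : X × (Fin n → X) → ℝ := fun p => f (e.symm p) with hF
    have hFm : Measurable F := hf.comp e.symm.measurable
    have hFB : ∀ p, |F p| ≤ B := fun p => hB _
    have hFi : Integrable F (D.prod (Measure.pi fun _ => D)) :=
      Integrable.of_bound hFm.aestronglyMeasurable B (ae_of_all _ fun p => hFB p)
    set g : (Fin n → X) → ℝ := fun y => ∫ a, F (a, y) ∂D with hg
    have hFa : ∀ y, Measurable fun a => F (a, y) := fun y => hFm.comp measurable_prodMk_right
    have hFai : ∀ y, Integrable (fun a => F (a, y)) D := fun y =>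
      Integrable.of_bound (hFa y).aestronglyMeasurable B (ae_of_all _ fun p => hFB _)
    have hgm : Measurable g :=
      (hFm.stronglyMeasurable.integral_prod_left').measurable
    have hgB : ∀ y, |g y| ≤ B := fun y => by
      have := norm_integral_le_of_norm_le_const (μ := D) (f := fun a => F (a, y)) (C := B)
        (ae_of_all _ fun p => hFB _)
      simpa using this
    -- Averaging out the first coordinate preserves the bounded differences, so the induction
    -- hypothesis applies to `g`.
    have hgd : ∀ x k y, g (Function.update x k y) ≤ g x + c := by
      intro x k y
      have h1 : g x + c = ∫ a, (F (a, x) + c) ∂D := by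
        rw [integral_add (hFai x) (integrable_const c)]; simp [hg]
      rw [h1]
      refine integral_mono (hFai _) ((hFai x).add (integrable_const c)) fun a => ?_
      have := hd (e.symm (a, x)) k.succ y
      simp only [hF, hsymm] at this ⊢
      rwa [Fin.cons_update]
    have hmean : ∫ x, f x ∂(Measure.pi fun _ => D) = ∫ y, g y ∂(Measure.pi fun _ => D) := by
      rw [htr f]
      exact integral_prod_symm F hFi
    rw [htr, hmean]
    set m := ∫ y, g y ∂(Measure.pi fun _ => D) with hm
    have hmB : |m| ≤ B := by
      have := norm_integral_le_of_norm_le_const (μ := Measure.pi fun _ : Fin n => D) (f := g)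
        (C := B) (ae_of_all _ fun p => hgB _)
      simpa using this
    have hexpi : Integrable (fun p => Real.exp (t * (F p - m)))
        (D.prod (Measure.pi fun _ => D)) := by
      refine Integrable.of_bound (by fun_prop) (Real.exp (|t| * (B + B))) (ae_of_all _ fun p => ?_)
      rw [Real.norm_eq_abs, Real.abs_exp, Real.exp_le_exp]
      refine (le_abs_self _).trans ?_
      rw [abs_mul]
      gcongr
      exact (abs_sub _ _).trans (add_le_add (hFB p) hmB)
    have hgexpi : Integrable (fun y => Real.exp (t * (g y - m))) (Measure.pi fun _ => D) := by
      refine Integrable.of_bound (by fun_prop) (Real.exp (|t| * (B + B))) (ae_of_all _ fun p => ?_)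
      rw [Real.norm_eq_abs, Real.abs_exp, Real.exp_le_exp]
      refine (le_abs_self _).trans ?_
      rw [abs_mul]
      gcongr
      exact (abs_sub _ _).trans (add_le_add (hgB p) hmB)
    have hinner : ∀ y, ∫ a, Real.exp (t * (F (a, y) - m)) ∂D ≤
        Real.exp ((c / 2) ^ 2 * t ^ 2 / 2) * Real.exp (t * (g y - m)) := by
      intro y
      have hbdd : BddBelow (Set.range fun a => F (a, y)) := by
        refine ⟨-B, ?_⟩
        rintro _ ⟨a, rfl⟩
        exact (abs_le.1 (hFB _)).1
      have : Nonempty X := nonempty_of_isProbabilityMeasure D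
      -- With the other coordinates fixed, any two values differ by at most `c`, so all lie in `[α,
      -- α + c]` and Hoeffding's lemma applies.
      set α := ⨅ a, F (a, y) with hα
      have hI : ∀ a, F (a, y) ∈ Set.Icc α (α + c) := by
        refine fun a => ⟨ciInf_le hbdd a, ?_⟩
        rw [← sub_le_iff_le_add]
        refine le_ciInf fun a' => ?_
        have := hd (e.symm (a', y)) 0 a
        simp only [hF, hsymm, Fin.update_cons_zero] at this ⊢
        linarith
      have hs := (hasSubgaussianMGF_of_mem_Icc (hFa y).aemeasurable
        (ae_of_all D hI)).mgf_le t
      have hcn : (((‖α + c - α‖₊ / 2) ^ 2 : NNReal) : ℝ) = (c / 2) ^ 2 := by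
        push_cast
        simp [abs_of_nonneg hc]
      rw [hcn] at hs
      have : ∀ a, Real.exp (t * (F (a, y) - m)) =
          Real.exp (t * (F (a, y) - g y)) * Real.exp (t * (g y - m)) := fun a => by
        rw [← Real.exp_add]; congr 1; ring
      simp_rw [this]
      rw [integral_mul_const]
      gcongr
      exact hs
    calc ∫ p, Real.exp (t * (f (e.symm p) - m)) ∂(D.prod (Measure.pi fun _ => D))
        = ∫ y, ∫ a, Real.exp (t * (F (a, y) - m)) ∂D ∂(Measure.pi fun _ => D) :=
          integral_prod_symm _ hexpi
      _ ≤ ∫ y, Real.exp ((c / 2) ^ 2 * t ^ 2 / 2) * Real.exp (t * (g y - m))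
            ∂(Measure.pi fun _ => D) :=
          integral_mono hexpi.integral_prod_right (hgexpi.const_mul _) hinner
      _ ≤ Real.exp ((c / 2) ^ 2 * t ^ 2 / 2) * Real.exp (n * (c / 2) ^ 2 * t ^ 2 / 2) := by
          rw [integral_const_mul]
          gcongr
          exact ih g hgm hgB hgd
      _ = _ := by
          rw [← Real.exp_add]; congr 1; push_cast; ring

/-- McDiarmid's inequality: the upper tail of a function with differences bounded by `1 / n`. -/
theorem measure_add_le_of_bounded_differences {X : Type*} [MeasurableSpace X] (D : Measure X)
    [IsProbabilityMeasure D] {n : ℕ} (hn : 0 < n) {f : (Fin n → X) → ℝ} (hf : Measurable f)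
    {B : ℝ} (hB : ∀ x, |f x| ≤ B)
    (hd : ∀ x k y, f (Function.update x k y) ≤ f x + 1 / n) {ε : ℝ} (hε : 0 ≤ ε) :
    Measure.pi (fun _ => D) {x | ∫ x', f x' ∂(Measure.pi fun _ => D) + ε ≤ f x} ≤
      ENNReal.ofReal (Real.exp (-2 * n * ε ^ 2)) := by
  have hn' : (0 : ℝ) < n := by exact_mod_cast hn
  set m := ∫ x', f x' ∂(Measure.pi fun _ => D) with hm
  have hmB : |m| ≤ B := by
    have := norm_integral_le_of_norm_le_const (μ := Measure.pi fun _ : Fin n => D) (f := f)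
      (C := B) (ae_of_all _ fun p => hB _)
    simpa using this
  have hint : Integrable (fun x => Real.exp (4 * n * ε * (f x - m))) (Measure.pi fun _ => D) := by
    refine Integrable.of_bound (by fun_prop) (Real.exp (|4 * n * ε| * (B + B)))
      (ae_of_all _ fun p => ?_)
    rw [Real.norm_eq_abs, Real.abs_exp, Real.exp_le_exp]
    refine (le_abs_self _).trans ?_
    rw [abs_mul]
    gcongr
    exact (abs_sub _ _).trans (add_le_add (hB p) hmB)
  -- The parameter `4nε` minimises the Chernoff exponent `-tε + t²/(8n)`, with minimum `-2nε²`.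
  have h := measure_ge_le_exp_mul_mgf (μ := Measure.pi fun _ : Fin n => D)
    (X := fun x => f x - m) (t := 4 * n * ε) ε (by positivity) hint
  have h2 := integral_exp_le_of_bounded_differences D (c := 1 / n) (by positivity) B (4 * n * ε)
    n f hf hB hd
  have hset : {x | m + ε ≤ f x} = {x | ε ≤ f x - m} := by
    ext x; simp [le_sub_iff_add_le, add_comm]
  rw [hset, ← ofReal_measureReal]
  refine ENNReal.ofReal_le_ofReal (h.trans ?_)
  refine (mul_le_mul_of_nonneg_left h2 (Real.exp_pos _).le).trans (le_of_eq ?_)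
  rw [← Real.exp_add]
  congr 1
  field_simp
  ring

/-! ### Contraction for Rademacher averages. -/

/-- One step of the contraction principle: a single coordinate may be replaced by one that
separates the index set at least as well. -/
theorem iSup_add_iSup_sub_le {ι : Type*} [Finite ι] [Nonempty ι] (h a b : ι → ℝ)
    (hab : ∀ i j, |b i - b j| ≤ |a i - a j|) :
    (⨆ i, (h i + b i)) + ⨆ i, (h i - b i) ≤ (⨆ i, (h i + a i)) + ⨆ i, (h i - a i) := by
  obtain ⟨i, hi⟩ := exists_eq_ciSup_of_finite (f := fun i => h i + b i)
  obtain ⟨j, hj⟩ := exists_eq_ciSup_of_finite (f := fun i => h i - b i)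
  rw [← hi, ← hj]
  have hp : ∀ k, h k + a k ≤ ⨆ i, (h i + a i) :=
    le_ciSup (f := fun i => h i + a i) (Set.finite_range _).bddAbove
  have hm : ∀ k, h k - a k ≤ ⨆ i, (h i - a i) :=
    le_ciSup (f := fun i => h i - a i) (Set.finite_range _).bddAbove
  have h1 := (le_abs_self _).trans (hab i j)
  -- The right side is symmetric under `a ↦ -a`: of the two maximisers, the one with the larger
  -- value of `a` is used in the supremum with `+a`.
  rcases abs_cases (a i - a j) with ⟨h2, _⟩ | ⟨h2, _⟩
  · linarith [hp i, hm j]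
  · linarith [hp j, hm i]

/-- The contraction principle for Rademacher averages over a finite index set. -/
theorem sum_iSup_rademacher_le_of_contraction {ι : Type*} [Finite ι] [Nonempty ι] :
    ∀ (n : ℕ) (c : ι → ℝ) (a b : ι → Fin n → ℝ),
      (∀ k i j, |b i k - b j k| ≤ |a i k - a j k|) →
      ∑ σ : Fin n → ℤˣ, ⨆ i, (c i + ∑ k, ((σ k : ℤ) : ℝ) * b i k) ≤
        ∑ σ : Fin n → ℤˣ, ⨆ i, (c i + ∑ k, ((σ k : ℤ) : ℝ) * a i k) := by
  intro n
  induction n with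
  | zero => intro c a b _; simp
  | succ n ih =>
    intro c a b hab
    have hs : ∀ G : (Fin (n + 1) → ℤˣ) → ℝ, ∑ σ, G σ =
        ∑ s : ℤˣ, ∑ σ : Fin n → ℤˣ, G (Fin.cons s σ) := fun G => by
      rw [← Fintype.sum_prod_type', ← (Fin.consEquiv fun _ => ℤˣ).sum_comp]
      rfl
    have hu : ∀ G : ℤˣ → ℝ, ∑ s, G s = G 1 + G (-1) := fun G => by
      rw [UnitsInt.univ, Finset.sum_pair (by decide)]
    rw [hs, hs]
    simp only [Fin.sum_univ_succ, Fin.cons_zero, Fin.cons_succ, ← add_assoc]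
    -- The first coordinate is absorbed into the offset `c` while the others are contracted; this is
    -- why the induction carries an arbitrary offset.
    calc _ ≤ ∑ s : ℤˣ, ∑ σ : Fin n → ℤˣ,
          ⨆ i, (c i + ((s : ℤ) : ℝ) * b i 0 + ∑ k, ((σ k : ℤ) : ℝ) * a i k.succ) :=
          Finset.sum_le_sum fun s _ => ih _ _ _ fun k i j => hab k.succ i j
      _ ≤ _ := by
          rw [Finset.sum_comm, Finset.sum_comm (s := (Finset.univ : Finset ℤˣ))]
          refine Finset.sum_le_sum fun σ _ => ?_
          rw [hu, hu]
          have := iSup_add_iSup_sub_le (fun i => c i + ∑ k, ((σ k : ℤ) : ℝ) * a i k.succ)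
            (fun i => a i 0) (fun i => b i 0) (hab 0)
          simp only [Units.val_one, Units.val_neg, Int.cast_one, Int.cast_neg, one_mul, neg_one_mul,
            add_right_comm, ← sub_eq_add_neg] at this ⊢
          simpa only [sub_eq_add_neg, add_right_comm] using this

/-! ### Symmetrisation and uniform deviations. -/

/-- Symmetrisation for a finite family of functions with values in `[0, 1]`. -/
theorem integral_iSup_deviation_le {X ι : Type*} [MeasurableSpace X] [Finite ι] [Nonempty ι]
    (D : Measure X) [IsProbabilityMeasure D] {n : ℕ} (hn : 0 < n) {h : ι → X → ℝ}
    (hm : ∀ i, Measurable (h i)) (h01 : ∀ i x, |h i x| ≤ 1) :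
    ∫ x, ⨆ i, (∫ a, h i a ∂D - (1 / (n : ℝ)) * ∑ k : Fin n, h i (x k)) ∂(Measure.pi fun _ => D) ≤
      2 * ∫ x, ((2 : ℝ) ^ n)⁻¹ * ∑ σ : Fin n → ℤˣ,
        ⨆ i, (1 / (n : ℝ)) * ∑ k, ((σ k : ℤ) : ℝ) * h i (x k) ∂(Measure.pi fun _ => D) := by
  have hn' : (0 : ℝ) < n := by exact_mod_cast hn
  have hfin : ∀ u : ι → ℝ, BddAbove (Set.range u) := fun u => (Set.finite_range u).bddAbove
  have hi : ∀ i, Integrable (h i) D := fun i =>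
    Integrable.of_bound (hm i).aestronglyMeasurable 1 (ae_of_all _ (h01 i))
  have hsup : ∀ {u : ι → ℝ} {B : ℝ}, (∀ i, |u i| ≤ B) → |⨆ i, u i| ≤ B := fun {u B} hu => by
    obtain ⟨i, hi⟩ := exists_eq_ciSup_of_finite (f := u)
    rw [← hi]; exact hu i
  have hs1 : ∀ s : ℤˣ, |((s : ℤ) : ℝ)| = 1 := fun s => by
    rcases Int.units_eq_one_or s with rfl | rfl <;> simp
  have havg : ∀ {u : Fin n → ℝ} {B : ℝ}, (∀ k, |u k| ≤ B) → |(1 / (n : ℝ)) * ∑ k, u k| ≤ B :=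
    fun {u B} hu => by
      rw [abs_mul, abs_of_pos (by positivity : 0 < 1 / (n : ℝ))]
      have := (Finset.abs_sum_le_sum_abs u Finset.univ).trans
        (Finset.sum_le_card_nsmul _ _ B fun k _ => hu k)
      simp only [Finset.card_univ, Fintype.card_fin, nsmul_eq_mul] at this
      rw [one_div, inv_mul_le_iff₀ hn']
      exact this
  -- integrals of signed suprema
  set μ : Measure (Fin n → X) := Measure.pi fun _ => D with hμ
  set ν : Measure (Fin n → X × X) := Measure.pi fun _ => D.prod D with hν
  have hsm : ∀ σ : Fin n → ℤˣ,
      Measurable fun x : Fin n → X => ⨆ i, (1 / (n : ℝ)) * ∑ k, ((σ k : ℤ) : ℝ) * h i (x k) :=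
    fun σ => Measurable.iSup fun i => by
      have := hm i
      fun_prop
  have hsi : ∀ σ : Fin n → ℤˣ,
      Integrable (fun x : Fin n → X => ⨆ i, (1 / (n : ℝ)) * ∑ k, ((σ k : ℤ) : ℝ) * h i (x k)) μ :=
    fun σ => Integrable.of_bound (hsm σ).aestronglyMeasurable 1 (ae_of_all _ fun x =>
      hsup fun i => havg fun k => by rw [abs_mul, hs1, one_mul]; exact h01 i _)
  set A : (Fin n → ℤˣ) → ℝ :=
    fun σ => ∫ x, ⨆ i, (1 / (n : ℝ)) * ∑ k, ((σ k : ℤ) : ℝ) * h i (x k) ∂μ with hA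
  set G : (Fin n → ℤˣ) → (Fin n → X × X) → ℝ :=
    fun σ z => ⨆ i, (1 / (n : ℝ)) * ∑ k, ((σ k : ℤ) : ℝ) * (h i (z k).2 - h i (z k).1) with hG
  have hGm : ∀ σ, Measurable (G σ) := fun σ => Measurable.iSup fun i => by
    have := hm i
    fun_prop
  have hGB : ∀ σ z, |G σ z| ≤ 2 := fun σ z => hsup fun i => havg fun k => by
    rw [abs_mul, hs1, one_mul]
    linarith [abs_sub (h i (z k).2) (h i (z k).1), h01 i (z k).2, h01 i (z k).1]
  have hGi : ∀ σ, Integrable (G σ) ν := fun σ =>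
    Integrable.of_bound (hGm σ).aestronglyMeasurable 2 (ae_of_all _ (hGB σ))
  have hfst : MeasurePreserving (fun (z : Fin n → X × X) k => (z k).1) ν μ :=
    measurePreserving_pi _ _ fun _ => measurePreserving_fst
  have hsnd : MeasurePreserving (fun (z : Fin n → X × X) k => (z k).2) ν μ :=
    measurePreserving_pi _ _ fun _ => measurePreserving_snd
  -- the ghost sample
  have hghost : ∫ x, ⨆ i, (∫ a, h i a ∂D - (1 / (n : ℝ)) * ∑ k : Fin n, h i (x k)) ∂μ ≤
      ∫ z, G 1 z ∂ν := by
    have hmp : MeasurePreserving (MeasurableEquiv.arrowProdEquivProdArrow X X (Fin n)) ν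
        (μ.prod μ) := measurePreserving_arrowProdEquivProdArrow X X (Fin n) _ _
    set e := MeasurableEquiv.arrowProdEquivProdArrow X X (Fin n) with he
    have hGei : Integrable (fun p => G 1 (e.symm p)) (μ.prod μ) :=
      (hmp.symm.integrable_comp_emb e.symm.measurableEmbedding).2 (hGi 1)
    rw [← hmp.symm.integral_comp' (G 1), integral_prod _ hGei]
    refine integral_mono (Integrable.of_bound (Measurable.aestronglyMeasurable
      (Measurable.iSup fun i => ?_)) 2 (ae_of_all _ fun x => hsup fun i => ?_))
      hGei.integral_prod_left fun x => ?_
    · have := hm i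
      fun_prop
    · have h1 : |∫ a, h i a ∂D| ≤ 1 := by
        have := norm_integral_le_of_norm_le_const (μ := D) (f := h i) (C := 1)
          (ae_of_all _ (h01 i))
        simpa using this
      have h2 : |(1 / (n : ℝ)) * ∑ k : Fin n, h i (x k)| ≤ 1 := havg fun k => h01 i _
      linarith [abs_sub (∫ a, h i a ∂D) ((1 / (n : ℝ)) * ∑ k : Fin n, h i (x k))]
    · refine ciSup_le fun i => ?_
      have hk : ∀ k : Fin n, Integrable (fun y : Fin n → X => h i (y k)) μ := fun k =>
        (measurePreserving_eval (fun _ : Fin n => D) k).integrable_comp_of_integrable (hi i)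
      have hkint : ∀ k : Fin n, ∫ y, h i (y k) ∂μ = ∫ a, h i a ∂D := fun k => by
        have := (measurePreserving_eval (fun _ : Fin n => D) k)
        rw [← this.map_eq, integral_map this.measurable.aemeasurable
          (hm i).aestronglyMeasurable]
      have h1 : ∫ a, h i a ∂D - (1 / (n : ℝ)) * ∑ k : Fin n, h i (x k) =
          ∫ y, (1 / (n : ℝ)) * ∑ k, (h i (y k) - h i (x k)) ∂μ := by
        have hki : ∀ k ∈ Finset.univ, Integrable (fun y : Fin n → X => h i (y k) - h i (x k)) μ :=
          fun k _ => (hk k).sub (integrable_const _)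
        rw [integral_const_mul, integral_finsetSum _ hki]
        simp_rw [integral_sub (hk _) (integrable_const _), hkint]
        simp only [integral_const, probReal_univ, Finset.sum_sub_distrib,
          Finset.sum_const, Finset.card_univ, Fintype.card_fin, nsmul_eq_mul, smul_eq_mul, one_mul]
        field_simp
      rw [h1]
      refine integral_mono (Integrable.const_mul (integrable_finsetSum _ fun k _ =>
        (hk k).sub (integrable_const _)) _) ?_ fun y => ?_
      · refine Integrable.of_bound ((hGm 1).comp (e.symm.measurable.comp
          measurable_prodMk_left)).aestronglyMeasurable 2 (ae_of_all _ fun y => hGB _ _)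
      · refine le_ciSup_of_le (hfin _) i (le_of_eq ?_)
        simp [he, MeasurableEquiv.arrowProdEquivProdArrow, Equiv.arrowProdEquivProdArrow]
  -- exchanging the two samples where the sign is negative
  have hswap : ∀ σ, ∫ z, G 1 z ∂ν = ∫ z, G σ z ∂ν := by
    intro σ
    have hmp : MeasurePreserving (fun (z : Fin n → X × X) k =>
        (if σ k = 1 then id else Prod.swap : X × X → X × X) (z k)) ν ν := by
      refine measurePreserving_pi _ _ fun k => ?_
      split_ifs
      · exact MeasurePreserving.id _
      · exact Measure.measurePreserving_swap
    rw [← hmp.map_eq, integral_map hmp.measurable.aemeasurable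
      (hGm 1).aestronglyMeasurable, hmp.map_eq]
    refine integral_congr_ae (ae_of_all _ fun z => ?_)
    simp only [hG]
    congr 1; ext i; congr 1
    refine Finset.sum_congr rfl fun k _ => ?_
    rcases Int.units_eq_one_or (σ k) with hk | hk <;> simp [hk]
  -- The supremum of a difference is at most a sum of two suprema, the minus sign turning `σ` into
  -- `-σ`. Summed over all signs, the two parts agree.
  have hsplit : ∀ σ, ∫ z, G σ z ∂ν ≤ A σ + A (-σ) := by
    intro σ
    have e1 : A σ = ∫ z, ⨆ i, (1 / (n : ℝ)) * ∑ k, ((σ k : ℤ) : ℝ) * h i (z k).2 ∂ν := by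
      simp only [hA]
      rw [← hsnd.map_eq, integral_map hsnd.measurable.aemeasurable
        (hsm σ).aestronglyMeasurable]
    have e2 : A (-σ) =
        ∫ z, ⨆ i, (1 / (n : ℝ)) * ∑ k, (((-σ) k : ℤ) : ℝ) * h i (z k).1 ∂ν := by
      simp only [hA]
      rw [← hfst.map_eq, integral_map hfst.measurable.aemeasurable
        (hsm (-σ)).aestronglyMeasurable]
    have i1 : Integrable (fun z : Fin n → X × X =>
        ⨆ i, (1 / (n : ℝ)) * ∑ k, ((σ k : ℤ) : ℝ) * h i (z k).2) ν := hsnd.integrable_comp_of_integrable (hsi σ)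
    have i2 : Integrable (fun z : Fin n → X × X =>
        ⨆ i, (1 / (n : ℝ)) * ∑ k, (((-σ) k : ℤ) : ℝ) * h i (z k).1) ν := hfst.integrable_comp_of_integrable (hsi (-σ))
    rw [e1, e2, ← integral_add i1 i2]
    refine integral_mono (hGi σ) (i1.add i2) fun z => ciSup_le fun i => ?_
    have l1 := le_ciSup (hfin fun i => (1 / (n : ℝ)) * ∑ k, ((σ k : ℤ) : ℝ) * h i (z k).2) i
    have l2 := le_ciSup (hfin fun i => (1 / (n : ℝ)) * ∑ k, (((-σ) k : ℤ) : ℝ) * h i (z k).1) i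
    refine le_trans (le_of_eq ?_) (add_le_add l1 l2)
    rw [← mul_add, ← Finset.sum_add_distrib]
    congr 1
    refine Finset.sum_congr rfl fun k _ => ?_
    simp; ring
  have hcard : (Fintype.card (Fin n → ℤˣ) : ℝ) = 2 ^ n := by simp
  have hsum : (2 : ℝ) ^ n * ∫ z, G 1 z ∂ν ≤ 2 * ∑ σ, A σ := by
    have hneg : ∑ σ, A (-σ) = ∑ σ, A σ := Equiv.sum_comp (Equiv.neg (Fin n → ℤˣ)) A
    calc (2 : ℝ) ^ n * ∫ z, G 1 z ∂ν = ∑ σ : Fin n → ℤˣ, ∫ z, G σ z ∂ν := by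
          simp_rw [← hswap]
          rw [Finset.sum_const, Finset.card_univ, nsmul_eq_mul, hcard]
      _ ≤ ∑ σ, (A σ + A (-σ)) := Finset.sum_le_sum fun σ _ => hsplit σ
      _ = 2 * ∑ σ, A σ := by rw [Finset.sum_add_distrib, hneg]; ring
  refine hghost.trans ?_
  rw [integral_const_mul, integral_finsetSum _ fun σ _ => hsi σ]
  rw [← mul_assoc, mul_comm (2 : ℝ), mul_assoc, ← div_eq_inv_mul, le_div_iff₀ (by positivity)]
  linarith

/-- For a finite subfamily of `F`, the expected uniform deviation after composition with a bounded
`L`-Lipschitz function is at most `2 L` times the Rademacher complexity of `F`. -/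
theorem integral_iSup_deviation_le_rademacherComplexity {X ι : Type*} [MeasurableSpace X] [Finite ι]
    [Nonempty ι] {F : Set (X → ℝ)} (D : Measure X) [IsProbabilityMeasure D] {n : ℕ} (hn : 0 < n)
    {R L : ℝ} (hR0 : 0 ≤ R) (hR : rademacherComplexity F D n ≤ ENNReal.ofReal R) (hL : 0 ≤ L)
    {φ : ℝ → ℝ} (hφm : Measurable φ) (hφ1 : ∀ t, |φ t| ≤ 1)
    (hφL : ∀ s t, |φ s - φ t| ≤ L * |s - t|)
    {g : ι → X → ℝ} (hgm : ∀ i, Measurable (g i)) (hgF : ∀ i, g i ∈ F) :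
    ∫ x, ⨆ i, (∫ a, φ (g i a) ∂D - (1 / (n : ℝ)) * ∑ k : Fin n, φ (g i (x k)))
      ∂(Measure.pi fun _ => D) ≤ 2 * L * R := by
  have hn' : (0 : ℝ) < n := by exact_mod_cast hn
  refine (integral_iSup_deviation_le D hn (h := fun i x => φ (g i x))
    (fun i => hφm.comp (hgm i)) fun i x => hφ1 _).trans ?_
  rw [mul_assoc]
  refine mul_le_mul_of_nonneg_left ?_ zero_le_two
  set Φ : (Fin n → X) → ℝ := fun x => ((2 : ℝ) ^ n)⁻¹ * ∑ σ : Fin n → ℤˣ,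
    ⨆ i, (1 / (n : ℝ)) * ∑ k, ((σ k : ℤ) : ℝ) * φ (g i (x k)) with hΦ
  have hpt : ∀ x, ENNReal.ofReal (Φ x) ≤ ENNReal.ofReal L * (((2 : ℝ≥0∞) ^ n)⁻¹ *
      ∑ σ : Fin n → ℤˣ,
        ⨆ g ∈ F, ENNReal.ofReal |(1 / (n : ℝ)) * ∑ k, ((σ k : ℤ) : ℝ) * g (x k)|) := by
    intro x
    set s : (Fin n → ℤˣ) → ℝ :=
      fun σ => ⨆ i, |(1 / (n : ℝ)) * ∑ k, ((σ k : ℤ) : ℝ) * g i (x k)| with hs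
    have hs0 : ∀ σ, 0 ≤ s σ := fun σ => Real.iSup_nonneg fun i => abs_nonneg _
    have h1 : Φ x ≤ L * (((2 : ℝ) ^ n)⁻¹ * ∑ σ, s σ) := by
      have hc := sum_iSup_rademacher_le_of_contraction n (fun _ : ι => 0)
        (fun i k => (1 / (n : ℝ)) * (L * g i (x k))) (fun i k => (1 / (n : ℝ)) * φ (g i (x k)))
        (fun k i j => by
          rw [← mul_sub, ← mul_sub, ← mul_sub, abs_mul, abs_mul, abs_mul, abs_of_nonneg hL]
          exact mul_le_mul_of_nonneg_left (hφL _ _) (abs_nonneg _))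
      rw [mul_left_comm]
      refine mul_le_mul_of_nonneg_left ?_ (by positivity)
      calc ∑ σ : Fin n → ℤˣ, ⨆ i, (1 / (n : ℝ)) * ∑ k, ((σ k : ℤ) : ℝ) * φ (g i (x k))
          = ∑ σ : Fin n → ℤˣ, ⨆ i, (0 + ∑ k, ((σ k : ℤ) : ℝ) * ((1 / (n : ℝ)) * φ (g i (x k)))) :=
            Finset.sum_congr rfl fun σ _ => by
              congr 1; ext i
              rw [zero_add, Finset.mul_sum]
              exact Finset.sum_congr rfl fun k _ => by ring
        _ ≤ _ := hc
        _ ≤ ∑ σ, L * s σ := Finset.sum_le_sum fun σ _ => ciSup_le fun i => by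
            have h2 : |(1 / (n : ℝ)) * ∑ k, ((σ k : ℤ) : ℝ) * g i (x k)| ≤ s σ :=
              le_ciSup (f := fun i => |(1 / (n : ℝ)) * ∑ k, ((σ k : ℤ) : ℝ) * g i (x k)|)
                (Set.finite_range _).bddAbove i
            refine le_trans (le_of_eq ?_)
              (mul_le_mul_of_nonneg_left ((le_abs_self _).trans h2) hL)
            rw [zero_add, Finset.mul_sum, Finset.mul_sum]
            exact Finset.sum_congr rfl fun k _ => by ring
        _ = L * ∑ σ, s σ := by rw [Finset.mul_sum]
    refine (ENNReal.ofReal_le_ofReal h1).trans ?_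
    rw [ENNReal.ofReal_mul hL, ENNReal.ofReal_mul (by positivity),
      ENNReal.ofReal_inv_of_pos (by positivity), ENNReal.ofReal_pow zero_le_two,
      ENNReal.ofReal_ofNat, ENNReal.ofReal_sum_of_nonneg fun σ _ => hs0 σ]
    gcongr with σ
    obtain ⟨i, hi⟩ := exists_eq_ciSup_of_finite
      (f := fun i => |(1 / (n : ℝ)) * ∑ k, ((σ k : ℤ) : ℝ) * g i (x k)|)
    simp only [hs, ← hi]
    exact le_iSup₂ (f := fun g (_ : g ∈ F) =>
      ENNReal.ofReal |(1 / (n : ℝ)) * ∑ k, ((σ k : ℤ) : ℝ) * g (x k)|) (g i) (hgF i)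
  have hle : ∫⁻ x, ENNReal.ofReal (Φ x) ∂(Measure.pi fun _ => D) ≤ ENNReal.ofReal (L * R) := by
    refine (lintegral_mono hpt).trans ?_
    -- A finite constant leaves the lower integral without measurability, so the supremum over all
    -- of `F` need not be measurable.
    rw [lintegral_const_mul' _ _ ENNReal.ofReal_ne_top, ENNReal.ofReal_mul hL]
    gcongr
    exact hR
  -- Otherwise the Bochner integral is `0` and the bound is trivial.
  by_cases hi : Integrable Φ (Measure.pi fun _ => D)
  · rw [integral_eq_lintegral_pos_part_sub_lintegral_neg_part hi]
    have := ENNReal.toReal_mono ENNReal.ofReal_ne_top hle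
    rw [ENNReal.toReal_ofReal (by positivity)] at this
    linarith [ENNReal.toReal_nonneg (a := ∫⁻ x, ENNReal.ofReal (-Φ x) ∂(Measure.pi fun _ => D))]
  · rw [integral_undef hi]; positivity

/-- Uniform deviations over a finite subfamily of `F` concentrate. -/
theorem measure_iSup_deviation_le {X ι : Type*} [MeasurableSpace X] [Finite ι]
    [Nonempty ι] {F : Set (X → ℝ)} (D : Measure X) [IsProbabilityMeasure D] {n : ℕ} (hn : 0 < n)
    {R L : ℝ} (hR0 : 0 ≤ R) (hR : rademacherComplexity F D n ≤ ENNReal.ofReal R) (hL : 0 ≤ L)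
    {φ : ℝ → ℝ} (hφm : Measurable φ) (hφ : ∀ t, φ t ∈ Set.Icc 0 1)
    (hφL : ∀ s t, |φ s - φ t| ≤ L * |s - t|)
    {g : ι → X → ℝ} (hgm : ∀ i, Measurable (g i)) (hgF : ∀ i, g i ∈ F) {ε : ℝ} (hε : 0 ≤ ε) :
    Measure.pi (fun _ => D) {x : Fin n → X | 2 * L * R + ε <
        ⨆ i, (∫ a, φ (g i a) ∂D - (1 / (n : ℝ)) * ∑ k : Fin n, φ (g i (x k)))} ≤
      ENNReal.ofReal (Real.exp (-2 * n * ε ^ 2)) := by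
  have hn' : (0 : ℝ) < n := by exact_mod_cast hn
  have hφ1 : ∀ t, |φ t| ≤ 1 := fun t => abs_le.2 ⟨by linarith [(hφ t).1], (hφ t).2⟩
  have hmean := integral_iSup_deviation_le_rademacherComplexity D hn hR0 hR hL hφm hφ1 hφL hgm hgF
  set f : (Fin n → X) → ℝ := fun x =>
    ⨆ i, (∫ a, φ (g i a) ∂D - (1 / (n : ℝ)) * ∑ k : Fin n, φ (g i (x k))) with hf
  have hfm : Measurable f := Measurable.iSup fun i => by
    have := hgm i
    fun_prop
  have hfB : ∀ x, |f x| ≤ 2 := by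
    intro x
    obtain ⟨i, hi⟩ := exists_eq_ciSup_of_finite
      (f := fun i => ∫ a, φ (g i a) ∂D - (1 / (n : ℝ)) * ∑ k : Fin n, φ (g i (x k)))
    simp only [hf, ← hi]
    have h1 : |∫ a, φ (g i a) ∂D| ≤ 1 := by
      have := norm_integral_le_of_norm_le_const (μ := D) (f := fun a => φ (g i a)) (C := 1)
        (ae_of_all _ fun a => hφ1 _)
      simpa using this
    have h2 : |(1 / (n : ℝ)) * ∑ k : Fin n, φ (g i (x k))| ≤ 1 := by
      rw [abs_mul, abs_of_pos (by positivity : 0 < 1 / (n : ℝ)), one_div, inv_mul_le_iff₀ hn']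
      refine (Finset.abs_sum_le_sum_abs _ _).trans
        ((Finset.sum_le_card_nsmul _ _ 1 fun k _ => hφ1 _).trans (by simp))
    linarith [abs_sub (∫ a, φ (g i a) ∂D) ((1 / (n : ℝ)) * ∑ k : Fin n, φ (g i (x k)))]
  -- One sample point affects one summand, which has weight `1/n` and values in `[0, 1]`; the
  -- supremum inherits the estimate.
  have hfd : ∀ x k y, f (Function.update x k y) ≤ f x + 1 / n := by
    intro x k y
    refine ciSup_le fun i => ?_
    have h1 : ∫ a, φ (g i a) ∂D - (1 / (n : ℝ)) * ∑ k : Fin n, φ (g i (x k)) ≤ f x :=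
      le_ciSup (f := fun i => ∫ a, φ (g i a) ∂D - (1 / (n : ℝ)) * ∑ k : Fin n, φ (g i (x k)))
        (Set.finite_range _).bddAbove i
    have h2 : ∑ l, φ (g i (x l)) ≤ ∑ l, φ (g i (Function.update x k y l)) + 1 := by
      rw [← Finset.add_sum_erase _ _ (Finset.mem_univ k),
        ← Finset.add_sum_erase _ (fun l => φ (g i (Function.update x k y l))) (Finset.mem_univ k)]
      have h3 : ∑ l ∈ Finset.univ.erase k, φ (g i (Function.update x k y l)) =
          ∑ l ∈ Finset.univ.erase k, φ (g i (x l)) := Finset.sum_congr rfl fun l hl => by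
        rw [Function.update_of_ne (Finset.ne_of_mem_erase hl)]
      rw [h3]
      linarith [(hφ (g i (x k))).2, (hφ (g i (Function.update x k y k))).1]
    have h4 := mul_le_mul_of_nonneg_left h2 (by positivity : 0 ≤ 1 / (n : ℝ))
    rw [mul_add, mul_one] at h4
    linarith
  refine le_trans (measure_mono fun x hx => ?_)
    (measure_add_le_of_bounded_differences D hn hfm hfB hfd hε)
  have : 2 * L * R + ε < f x := hx
  simp only [Set.mem_ofPred_eq]
  linarith

/-- Uniform deviations over a pointwise measurable class concentrate. -/
theorem PointwiseMeasurable.measure_deviation_le {X : Type*} [MeasurableSpace X]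
    {F : Set (X → ℝ)} (hF : PointwiseMeasurable F) (D : Measure X) [IsProbabilityMeasure D]
    {n : ℕ} (hn : 0 < n) {R L : ℝ} (hR0 : 0 ≤ R)
    (hR : rademacherComplexity F D n ≤ ENNReal.ofReal R) (hL : 0 ≤ L)
    {φ : ℝ → ℝ} (hφc : Continuous φ) (hφ : ∀ t, φ t ∈ Set.Icc 0 1)
    (hφL : ∀ s t, |φ s - φ t| ≤ L * |s - t|) {ε : ℝ} (hε : 0 ≤ ε) :
    Measure.pi (fun _ => D) {x : Fin n → X | ∃ g ∈ F, 2 * L * R + ε <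
        ∫ a, φ (g a) ∂D - (1 / (n : ℝ)) * ∑ k : Fin n, φ (g (x k))} ≤
      ENNReal.ofReal (Real.exp (-2 * n * ε ^ 2)) := by
  obtain ⟨hFm, F₀, hF₀, hcount, hlim⟩ := hF
  rcases F₀.eq_empty_or_nonempty with rfl | hne
  · have : {x : Fin n → X | ∃ g ∈ F, 2 * L * R + ε <
        ∫ a, φ (g a) ∂D - (1 / (n : ℝ)) * ∑ k : Fin n, φ (g (x k))} = ∅ := by
      rw [Set.eq_empty_iff_forall_notMem]
      rintro x ⟨g, hg, -⟩
      obtain ⟨u, hu, -⟩ := hlim g hg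
      exact hu 0
    rw [this]; simp
  obtain ⟨v, rfl⟩ := hcount.exists_eq_range hne
  -- Suprema over initial segments of the countable subclass give increasing events with a tail
  -- bound independent of `m`. A strict excess for a limit function already occurs along the
  -- approximating sequence, by dominated convergence.
  set T : ℕ → Set (Fin n → X) := fun m => {x | 2 * L * R + ε <
    ⨆ i : Fin (m + 1), (∫ a, φ (v i a) ∂D - (1 / (n : ℝ)) * ∑ k : Fin n, φ (v i (x k)))} with hT
  have hmem : ∀ m x, x ∈ T m ↔ ∃ i < m + 1, 2 * L * R + ε <
      ∫ a, φ (v i a) ∂D - (1 / (n : ℝ)) * ∑ k : Fin n, φ (v i (x k)) := by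
    intro m x
    simp only [hT, Set.mem_ofPred_eq]
    rw [lt_ciSup_iff (Set.finite_range _).bddAbove]
    exact ⟨fun ⟨i, hi⟩ => ⟨i, i.2, hi⟩, fun ⟨i, him, hi⟩ => ⟨⟨i, him⟩, hi⟩⟩
  have hmono : Monotone T := by
    intro m m' hmm x hx
    rw [hmem] at hx ⊢
    obtain ⟨i, hi, h⟩ := hx
    exact ⟨i, by omega, h⟩
  have hsub : {x : Fin n → X | ∃ g ∈ F, 2 * L * R + ε <
      ∫ a, φ (g a) ∂D - (1 / (n : ℝ)) * ∑ k : Fin n, φ (g (x k))} ⊆ ⋃ m, T m := by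
    rintro x ⟨g, hg, hx⟩
    obtain ⟨u, hu, hug⟩ := hlim g hg
    have hint : Tendsto (fun m => ∫ a, φ (u m a) ∂D) atTop (𝓝 (∫ a, φ (g a) ∂D)) := by
      refine tendsto_integral_of_dominated_convergence (fun _ => 1)
        (fun m => (hφc.measurable.comp (hFm _ (hF₀ (hu m)))).aestronglyMeasurable)
        (integrable_const _) (fun m => ae_of_all _ fun a => ?_) (ae_of_all _ fun a => ?_)
      · rw [Real.norm_eq_abs, abs_le]
        exact ⟨by linarith [(hφ (u m a)).1], (hφ _).2⟩
      · exact (hφc.tendsto _).comp (hug a)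
    have hall : Tendsto (fun m => ∫ a, φ (u m a) ∂D - (1 / (n : ℝ)) * ∑ k : Fin n, φ (u m (x k)))
        atTop (𝓝 (∫ a, φ (g a) ∂D - (1 / (n : ℝ)) * ∑ k : Fin n, φ (g (x k)))) :=
      hint.sub (Tendsto.const_mul _ (tendsto_finsetSum _ fun k _ =>
        (hφc.tendsto _).comp (hug (x k))))
    obtain ⟨m, hm⟩ := (hall.eventually (lt_mem_nhds hx)).exists
    obtain ⟨i, hi⟩ := hu m
    rw [Set.mem_iUnion]
    refine ⟨i, (hmem i x).2 ⟨i, Nat.lt_succ_self i, ?_⟩⟩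
    rw [hi]; exact hm
  refine (measure_mono hsub).trans ?_
  rw [hmono.measure_iUnion]
  exact iSup_le fun m => measure_iSup_deviation_le D hn hR0 hR hL hφc.measurable hφ hφL
    (fun i : Fin (m + 1) => hFm _ (hF₀ ⟨i, rfl⟩)) (fun i => hF₀ ⟨i, rfl⟩) hε

/-! ### Ramp loss and the union over margin scales. -/

/-- The ramp function: `1` up to `0`, `0` from `a` on, and linear in between. -/
noncomputable def ramp (a s : ℝ) : ℝ := max 0 (min 1 (1 - s / a))

theorem continuous_ramp (a : ℝ) : Continuous (ramp a) := by unfold ramp; fun_prop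

theorem ramp_mem_Icc (a s : ℝ) : ramp a s ∈ Set.Icc 0 1 :=
  ⟨le_max_left _ _, max_le zero_le_one (min_le_left _ _)⟩

theorem abs_ramp_sub_ramp_le {a : ℝ} (ha : 0 < a) (s t : ℝ) :
    |ramp a s - ramp a t| ≤ 1 / a * |s - t| := by
  have h1 : |min 1 (1 - s / a) - min 1 (1 - t / a)| ≤ |(1 - s / a) - (1 - t / a)| := by
    simpa using abs_min_sub_min_le_max 1 (1 - s / a) 1 (1 - t / a)
  have h2 : |ramp a s - ramp a t| ≤ |min 1 (1 - s / a) - min 1 (1 - t / a)| := by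
    simpa [ramp] using abs_max_sub_max_le_max 0 (min 1 (1 - s / a)) 0 (min 1 (1 - t / a))
  refine h2.trans (h1.trans (le_of_eq ?_))
  rw [show (1 - s / a) - (1 - t / a) = 1 / a * -(s - t) by ring, abs_mul, abs_neg,
    abs_of_pos (by positivity)]

theorem ramp_of_nonpos {a s : ℝ} (ha : 0 < a) (hs : s ≤ 0) : ramp a s = 1 := by
  have : s / a ≤ 0 := div_nonpos_of_nonpos_of_nonneg hs ha.le
  rw [ramp, min_eq_left (by linarith)]
  simp

theorem ramp_of_lt {a s : ℝ} (ha : 0 < a) (hs : a < s) : ramp a s = 0 := by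
  have : 1 < s / a := (one_lt_div ha).2 hs
  rw [ramp, max_eq_left ((min_le_right _ _).trans (by linarith))]

/-- Each term is at most `1/(k+1) - 1/(k+2)`, and the sum telescopes. -/
theorem tsum_inv_add_two_sq_le : ∑' k : ℕ, ENNReal.ofReal (1 / ((k : ℝ) + 2) ^ 2) ≤ 1 := by
  refine ENNReal.tsum_le_of_sum_range_le fun m => ?_
  have h : ∑ k ∈ Finset.range m, 1 / ((k : ℝ) + 2) ^ 2 ≤ 1 - 1 / ((m : ℝ) + 1) := by
    induction m with
    | zero => simp
    | succ m ih =>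
      rw [Finset.sum_range_succ]
      have : 1 / ((m : ℝ) + 2) ^ 2 ≤ 1 / ((m : ℝ) + 1) - 1 / ((m : ℝ) + 2) := by
        rw [div_sub_div _ _ (by positivity) (by positivity)]
        gcongr <;> nlinarith [(Nat.cast_nonneg m : (0 : ℝ) ≤ m)]
      push_cast
      rw [show (m : ℝ) + 1 + 1 = m + 2 by ring]
      linarith
  rw [← ENNReal.ofReal_sum_of_nonneg fun _ _ => by positivity, ENNReal.ofReal_le_one]
  have : 0 ≤ 1 / ((m : ℝ) + 1) := by positivity
  linarith

open Classical in
/-- The margin bound for one distribution, uniform over the class and over all margins `γ < K`. -/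
theorem PointwiseMeasurable.measure_margin_bound_fails_le {X : Type*} [MeasurableSpace X]
    {F : Set (X → ℝ)} (hF : PointwiseMeasurable F) (D : Measure X) [IsProbabilityMeasure D]
    {n : ℕ} (hn : 0 < n) {R : ℝ} (hR0 : 0 ≤ R)
    (hR : rademacherComplexity F D n ≤ ENNReal.ofReal R) (K : ℝ) {t : ℝ} (ht : 0 ≤ t) :
    Measure.pi (fun _ => D) {x : Fin n → X | ∃ g ∈ F, ∃ γ, 0 < γ ∧ γ < K ∧
        4 * R / γ + Real.sqrt (logLogTerm K γ / n)
          + (∑ k : Fin n, (if g (x k) ≤ γ then (1 : ℝ) else 0) / n) + t <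
        D.real {a | g a ≤ 0}} ≤
      ENNReal.ofReal (Real.exp (-2 * n * t ^ 2)) := by
  have hn' : (0 : ℝ) < n := by exact_mod_cast hn
  rcases le_or_gt K 0 with hK | hK
  · refine le_trans (le_of_eq ?_) zero_le
    convert measure_empty (μ := Measure.pi fun _ : Fin n => D)
    rw [Set.eq_empty_iff_forall_notMem]
    rintro x ⟨g, -, γ, h1, h2, -⟩
    linarith
  set a : ℕ → ℝ := fun k => K / 2 ^ (k + 1) with ha
  have ha0 : ∀ k, 0 < a k := fun k => by positivity
  -- Since `ε k ^ 2 ≥ t² + log(k+2)/n`, the tail at scale `k` gains the factor `1/(k+2)²`.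
  set ε : ℕ → ℝ := fun k => t + Real.sqrt (Real.log (k + 2) / n) with hε
  have hlog : ∀ k : ℕ, 0 ≤ Real.log ((k : ℝ) + 2) := fun k =>
    Real.log_nonneg (by linarith [(Nat.cast_nonneg k : (0 : ℝ) ≤ k)])
  have hε0 : ∀ k, 0 ≤ ε k := fun k => add_nonneg ht (Real.sqrt_nonneg _)
  set T : ℕ → Set (Fin n → X) := fun k => {x | ∃ g ∈ F, 2 * (1 / a k) * R + ε k <
    ∫ y, ramp (a k) (g y) ∂D - (1 / (n : ℝ)) * ∑ l : Fin n, ramp (a k) (g (x l))} with hT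
  have hTle : ∀ k, Measure.pi (fun _ => D) (T k) ≤
      ENNReal.ofReal (Real.exp (-2 * n * t ^ 2)) * ENNReal.ofReal (1 / ((k : ℝ) + 2) ^ 2) := by
    intro k
    refine (hF.measure_deviation_le D hn hR0 hR (one_div_nonneg.2 (ha0 k).le)
      (continuous_ramp (a k)) (ramp_mem_Icc _) (abs_ramp_sub_ramp_le (ha0 k)) (hε0 k)).trans ?_
    rw [← ENNReal.ofReal_mul (Real.exp_pos _).le]
    refine ENNReal.ofReal_le_ofReal ?_
    have h1 : t ^ 2 + Real.log (k + 2) / n ≤ ε k ^ 2 := by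
      have := Real.sq_sqrt (div_nonneg (hlog k) hn'.le)
      simp only [hε]
      nlinarith [mul_nonneg ht (Real.sqrt_nonneg (Real.log ((k : ℝ) + 2) / n))]
    have h2 : 1 / ((k : ℝ) + 2) ^ 2 = Real.exp (-2 * Real.log (k + 2)) := by
      rw [show -2 * Real.log ((k : ℝ) + 2) = -(((2 : ℕ) : ℝ) * Real.log (k + 2)) by push_cast; ring,
        Real.exp_neg, Real.exp_nat_mul, Real.exp_log (by positivity), one_div]
    rw [h2, ← Real.exp_add, Real.exp_le_exp]
    have h3 := mul_le_mul_of_nonneg_left h1 (by positivity : 0 ≤ 2 * (n : ℝ))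
    have h4 : 2 * (n : ℝ) * (t ^ 2 + Real.log (k + 2) / n) =
        2 * n * t ^ 2 + 2 * Real.log (k + 2) := by
      field_simp
    linarith
  have hsub : {x : Fin n → X | ∃ g ∈ F, ∃ γ, 0 < γ ∧ γ < K ∧
        4 * R / γ + Real.sqrt (logLogTerm K γ / n)
          + (∑ k : Fin n, (if g (x k) ≤ γ then (1 : ℝ) else 0) / n) + t <
        D.real {a | g a ≤ 0}} ⊆ ⋃ k, T k := by
    rintro x ⟨g, hg, γ, hγ, hγK, hlt⟩
    -- From `2^k ≤ K/γ < 2^(k+1)` follows `a k < γ ≤ 2 * a k`. The left half compares ramp and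
    -- indicator, the right half turns `2R / a k` into `4R/γ`.
    obtain ⟨k, hk1, hk2⟩ := exists_nat_pow_near ((one_le_div hγ).2 hγK.le) one_lt_two
    rw [le_div_iff₀ hγ] at hk1
    rw [div_lt_iff₀ hγ] at hk2
    refine Set.mem_iUnion.2 ⟨k, g, hg, ?_⟩
    have hgm := hF.1 g hg
    have haγ : a k < γ := by
      rw [ha, div_lt_iff₀ (by positivity)]; linarith
    have hcomp : 2 * (1 / a k) * R ≤ 4 * R / γ := by
      have h5 : 1 / a k ≤ 2 / γ := by
        rw [div_le_div_iff₀ (ha0 k) hγ, one_mul]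
        simp only [ha, pow_succ]
        rw [show 2 * (K / (2 ^ k * 2)) = K / 2 ^ k by field_simp, le_div_iff₀ (by positivity)]
        linarith
      calc 2 * (1 / a k) * R ≤ 2 * (2 / γ) * R := by gcongr
        _ = 4 * R / γ := by ring
    -- Here `2^(k+2) = 4 * 2^k ≤ 4K/γ`, which is the source of the `4` inside the logarithm.
    have hll : Real.log ((k : ℝ) + 2) ≤ logLogTerm K γ := by
      refine Real.log_le_log (by positivity) (le_trans ?_ (le_max_right _ _))
      rw [Real.le_logb_iff_rpow_le one_lt_two (by positivity), le_div_iff₀ hγ]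
      have : (2 : ℝ) ^ ((k : ℝ) + 2) = 2 ^ k * 4 := by
        rw [Real.rpow_add two_pos, Real.rpow_natCast]; norm_num
      rw [this]; linarith
    have hsq : Real.sqrt (Real.log (k + 2) / n) ≤ Real.sqrt (logLogTerm K γ / n) :=
      Real.sqrt_le_sqrt (by gcongr)
    have hemp : (1 / (n : ℝ)) * ∑ l : Fin n, ramp (a k) (g (x l)) ≤
        ∑ l : Fin n, (if g (x l) ≤ γ then (1 : ℝ) else 0) / n := by
      rw [Finset.mul_sum]
      refine Finset.sum_le_sum fun l _ => ?_
      rw [one_div, inv_mul_eq_div]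
      gcongr
      split_ifs with h
      · exact (ramp_mem_Icc _ _).2
      · exact (ramp_of_lt (ha0 k) (haγ.trans (not_le.1 h))).le
    have hpop : D.real {a | g a ≤ 0} ≤ ∫ y, ramp (a k) (g y) ∂D := by
      have hs : MeasurableSet {a | g a ≤ 0} := measurableSet_le hgm measurable_const
      rw [← integral_indicator_one hs]
      refine integral_mono ((integrable_const (1 : ℝ)).indicator hs) (Integrable.of_bound
        ((continuous_ramp _).measurable.comp hgm).aestronglyMeasurable 1
        (ae_of_all _ fun y => ?_)) fun y => ?_
      · rw [Real.norm_eq_abs, abs_of_nonneg (ramp_mem_Icc _ _).1]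
        exact (ramp_mem_Icc _ _).2
      · by_cases hy : g y ≤ 0
        · rw [Set.indicator_of_mem (show y ∈ {a | g a ≤ 0} from hy), ramp_of_nonpos (ha0 k) hy]
          rfl
        · rw [Set.indicator_of_notMem (show y ∉ {a | g a ≤ 0} from hy)]
          exact (ramp_mem_Icc _ _).1
    simp only [hε]
    linarith
  calc _ ≤ Measure.pi (fun _ => D) (⋃ k, T k) := measure_mono hsub
    _ ≤ ∑' k, Measure.pi (fun _ => D) (T k) := measure_iUnion_le _
    _ ≤ ∑' k : ℕ, ENNReal.ofReal (Real.exp (-2 * n * t ^ 2)) *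
          ENNReal.ofReal (1 / ((k : ℝ) + 2) ^ 2) := ENNReal.tsum_le_tsum hTle
    _ ≤ ENNReal.ofReal (Real.exp (-2 * n * t ^ 2)) := by
        rw [ENNReal.tsum_mul_left]
        exact mul_le_of_le_one_right' tsum_inv_add_two_sq_le

/-! ### Conditioning on the labels. -/

/-- A bound on the conditional probabilities given the value of a discrete variable is a bound on
the conditional probability given that the variable lies in a set. -/
theorem cond_preimage_le {Ω Λ : Type*} [MeasurableSpace Ω] [Fintype Λ] (μ : Measure Ω)
    [IsFiniteMeasure μ] (Y : Ω → Λ) (hY : ∀ l, MeasurableSet {ω | Y ω = l}) (Q : Set Λ)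
    (B : Set Ω) (δ : ℝ≥0∞) (h : ∀ l ∈ Q, μ[|{ω | Y ω = l}] B ≤ δ) :
    μ[|{ω | Y ω ∈ Q}] B ≤ δ := by
  classical
  have hU : {ω | Y ω ∈ Q} = ⋃ l ∈ Finset.univ.filter (· ∈ Q), {ω | Y ω = l} := by
    ext ω; simp
  have hQ : MeasurableSet {ω | Y ω ∈ Q} := by
    rw [hU]; exact Finset.measurableSet_biUnion _ fun l _ => hY l
  have hμQ : μ {ω | Y ω ∈ Q} = ∑ l ∈ Finset.univ.filter (· ∈ Q), μ {ω | Y ω = l} := by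
    rw [hU]
    refine measure_biUnion_finset (fun l _ l' _ hll => ?_) fun l _ => hY l
    exact Set.disjoint_left.2 fun ω h1 h2 => hll (h1.symm.trans h2)
  rw [cond_apply hQ]
  have hle : μ ({ω | Y ω ∈ Q} ∩ B) ≤ δ * μ {ω | Y ω ∈ Q} := by
    have : {ω | Y ω ∈ Q} ∩ B ⊆ ⋃ l ∈ Finset.univ.filter (· ∈ Q), ({ω | Y ω = l} ∩ B) := by
      rintro ω ⟨h1, h2⟩
      simp only [Set.mem_iUnion]
      exact ⟨Y ω, by simpa using h1, rfl, h2⟩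
    refine (measure_mono this).trans ((measure_biUnion_finset_le _ _).trans ?_)
    rw [hμQ, Finset.mul_sum]
    refine Finset.sum_le_sum fun l hl => ?_
    rw [← cond_mul_eq_inter (hY l)]
    gcongr
    exact h l (by simpa using hl)
  calc (μ {ω | Y ω ∈ Q})⁻¹ * μ ({ω | Y ω ∈ Q} ∩ B)
      ≤ (μ {ω | Y ω ∈ Q})⁻¹ * (δ * μ {ω | Y ω ∈ Q}) := by gcongr
    _ = δ * ((μ {ω | Y ω ∈ Q})⁻¹ * μ {ω | Y ω ∈ Q}) := by ring
    -- The inequality also covers a null conditioning event, where the product is `0`.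
    _ ≤ δ := mul_le_of_le_one_right' (ENNReal.inv_mul_le_one _)

/-- A product measure conditioned on a box is the product of the conditioned measures. -/
theorem cond_pi {ι Z : Type*} [Fintype ι] [MeasurableSpace Z] (P : Measure Z)
    [IsProbabilityMeasure P] (s : ι → Set Z) (hs : ∀ k, MeasurableSet (s k)) :
    (Measure.pi fun _ : ι => P)[|Set.univ.pi s] = Measure.pi fun k => P[|s k] := by
  refine (Measure.pi_eq fun u _ => ?_).symm
  rw [cond_apply (MeasurableSet.univ_pi hs), ← Set.pi_inter_distrib, Measure.pi_pi, Measure.pi_pi]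
  simp_rw [fun k => cond_apply (hs k) P (u k)]
  rw [Finset.prod_mul_distrib, ENNReal.prod_inv_distrib]
  intro i _ j _ _
  exact Or.inr (measure_ne_top _ _)

theorem measurableSet_snd_eq {X : Type*} [MeasurableSpace X] {C : ℕ} (i : Fin C) :
    MeasurableSet {z : X × Fin C | z.2 = i} :=
  measurable_snd (measurableSet_singleton i)

/-- Given the labels, the inputs of the samples of class `i` are i.i.d. with the class law. -/
theorem map_fst_comp_pi_cond {X : Type*} [MeasurableSpace X] {C N n : ℕ} (P : Measure (X × Fin C))
    [IsProbabilityMeasure P] (hp : ∀ i, P {z | z.2 = i} ≠ 0) (l : Fin N → Fin C) (i : Fin C)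
    (e : Fin n ↪ Fin N) (he : ∀ k, l (e k) = i) :
    (Measure.pi fun k => P[|{z : X × Fin C | z.2 = l k}]).map (fun S k => (S (e k)).1) =
      Measure.pi fun _ => classCond P i := by
  have : ∀ k, IsProbabilityMeasure (P[|{z : X × Fin C | z.2 = l k}]) :=
    fun k => cond_isProbabilityMeasure (hp _)
  have h1 : iIndepFun (fun k (S : Fin N → X × Fin C) => (S k).1)
      (Measure.pi fun k => P[|{z : X × Fin C | z.2 = l k}]) :=
    iIndepFun_pi (Ω := fun _ => X × Fin C) (X := fun _ => Prod.fst) fun k => measurable_fst.aemeasurable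
  have h2 := h1.precomp e.injective
  replace h2 := (iIndepFun_iff_map_fun_eq_pi_map (f := fun k (S : Fin N → X × Fin C) => (S (e k)).1)
    fun k => (measurable_fst.comp (measurable_pi_apply (e k))).aemeasurable).1 h2
  refine h2.trans ?_
  congr 1
  ext k : 1
  have h3 := (measurePreserving_eval (fun k => P[|{z : X × Fin C | z.2 = l k}]) (e k)).map_eq
  rw [he] at h3
  rw [classCond, ← h3, Measure.map_map measurable_fst (measurable_pi_apply _)]
  rfl

/-! ### Sums and extrema of inverse margins. -/

theorem sum_sum_erase_const {C : ℕ} (a : ℝ) :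
    ∑ i : Fin C, ∑ _j ∈ Finset.univ.erase i, a = (C : ℝ) * (C - 1) * a := by
  rcases Nat.eq_zero_or_pos C with rfl | hC
  · simp
  · simp only [Finset.sum_const, Finset.card_erase_of_mem (Finset.mem_univ _), Finset.card_univ,
      Fintype.card_fin, nsmul_eq_mul, Nat.cast_sub (Nat.one_le_of_lt hC), Nat.cast_one]
    ring

theorem nonempty_offDiag {C : ℕ} (hC : 2 ≤ C) :
    Nonempty {q : Fin C × Fin C // q.1 ≠ q.2} :=
  ⟨⟨(⟨0, by omega⟩, ⟨1, by omega⟩), by simp⟩⟩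

theorem one_div_le_maxInvMargin {C : ℕ} (γ : Fin C → Fin C → ℝ) {i j : Fin C} (hij : i ≠ j) :
    1 / γ i j ≤ maxInvMargin γ :=
  le_ciSup (f := fun q : {q : Fin C × Fin C // q.1 ≠ q.2} => 1 / γ q.1.1 q.1.2)
    (Set.finite_range _).bddAbove ⟨(i, j), hij⟩

theorem sumInvMargin_le {C : ℕ} (γ : Fin C → Fin C → ℝ) :
    sumInvMargin γ ≤ (C : ℝ) * (C - 1) * maxInvMargin γ := by
  rw [← sum_sum_erase_const]
  exact Finset.sum_le_sum fun i _ => Finset.sum_le_sum fun j hj =>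
    one_div_le_maxInvMargin γ (Finset.ne_of_mem_erase hj).symm

theorem IsMarginFamily.minMargin_pos {C : ℕ} (hC : 2 ≤ C) {γ : Fin C → Fin C → ℝ}
    (hγ : IsMarginFamily γ) : 0 < minMargin γ := by
  have := nonempty_offDiag hC
  obtain ⟨q, hq⟩ := exists_eq_ciInf_of_finite
    (f := fun q : {q : Fin C × Fin C // q.1 ≠ q.2} => γ q.1.1 q.1.2)
  rw [minMargin, ← hq]
  exact hγ _ _ q.2

theorem IsMarginFamily.maxInvMargin_eq {C : ℕ} (hC : 2 ≤ C) {γ : Fin C → Fin C → ℝ}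
    (hγ : IsMarginFamily γ) : maxInvMargin γ = 1 / minMargin γ := by
  have := nonempty_offDiag hC
  refine le_antisymm (ciSup_le fun q => ?_) ?_
  · exact one_div_le_one_div_of_le (hγ.minMargin_pos hC)
      (ciInf_le (f := fun q : {q : Fin C × Fin C // q.1 ≠ q.2} => γ q.1.1 q.1.2)
        (Set.finite_range _).bddBelow q)
  · obtain ⟨q, hq⟩ := exists_eq_ciInf_of_finite
      (f := fun q : {q : Fin C × Fin C // q.1 ≠ q.2} => γ q.1.1 q.1.2)
    rw [minMargin, ← hq]
    exact one_div_le_maxInvMargin γ q.2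

theorem IsMarginFamily.sumInvMargin_pos {C : ℕ} (hC : 2 ≤ C) {γ : Fin C → Fin C → ℝ}
    (hγ : IsMarginFamily γ) : 0 < sumInvMargin γ := by
  have : ∀ i, ∀ j ∈ Finset.univ.erase i, 0 < 1 / γ i j := fun i j hj =>
    one_div_pos.2 (hγ i j (Finset.ne_of_mem_erase hj).symm)
  refine Finset.sum_pos (fun i _ => Finset.sum_pos (this i) ?_) ⟨⟨0, by omega⟩, Finset.mem_univ _⟩
  rw [← Finset.card_pos, Finset.card_erase_of_mem (Finset.mem_univ _)]
  simp; omega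

theorem sInf_sumInvMargin_le {C : ℕ} (hC : 2 ≤ C) {Γ : Set (Fin C → Fin C → ℝ)}
    (hne : Γ.Nonempty) (hΓ : ∀ γ ∈ Γ, IsMarginFamily γ) :
    1 / ((C : ℝ) * (C - 1)) * sInf (sumInvMargin '' Γ) ≤ sInf (maxInvMargin '' Γ) := by
  have hC' : (2 : ℝ) ≤ C := by exact_mod_cast hC
  refine le_csInf (hne.image _) ?_
  rintro _ ⟨γ, hγ, rfl⟩
  rw [one_div, inv_mul_le_iff₀ (by nlinarith)]
  -- A real `sInf` bounds its elements from below only when the set is bounded below; positivity of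
  -- the margins supplies this.
  have hbdd : BddBelow (sumInvMargin '' Γ) := ⟨0, ?_⟩
  · exact (csInf_le hbdd (Set.mem_image_of_mem _ hγ)).trans (sumInvMargin_le γ)
  rintro _ ⟨γ', hγ', rfl⟩
  exact ((hΓ γ' hγ').sumInvMargin_pos hC).le

theorem isMinOn_maxInvMargin_iff {C : ℕ} (hC : 2 ≤ C) {Γ : Set (Fin C → Fin C → ℝ)}
    (hΓ : ∀ γ ∈ Γ, IsMarginFamily γ) {γ : Fin C → Fin C → ℝ} (hγ : γ ∈ Γ) :
    IsMinOn maxInvMargin Γ γ ↔ IsMaxOn minMargin Γ γ := by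
  rw [isMinOn_iff, isMaxOn_iff]
  refine forall₂_congr fun γ' hγ' => ?_
  rw [(hΓ γ hγ).maxInvMargin_eq hC, (hΓ γ' hγ').maxInvMargin_eq hC]
  exact one_div_le_one_div ((hΓ γ hγ).minMargin_pos hC) ((hΓ γ' hγ').minMargin_pos hC)

/-! ### Reduction to the balanced form. -/

theorem IsBalanced.classCount_eq {X : Type*} {C N : ℕ} (hC : 0 < C) (hCN : C ∣ N)
    {S : Fin N → X × Fin C} (hS : IsBalanced S) (i : Fin C) : classCount S i = N / C := by
  have hC' : (C : ℝ) ≠ 0 := by positivity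
  have := hS i
  rw [← Nat.cast_div hCN hC'] at this
  exact_mod_cast this

/-- With equal class proportions, the multiclass bound of a balanced training set is the balanced
bound. -/
theorem IsBalanced.multiclassMarginBound_eq {X W : Type*} [MeasurableSpace X] {C d N : ℕ}
    (hC : 2 ≤ C) (hN : 0 < N) (hCN : C ∣ N) {P : Measure (X × Fin C)}
    (hp : ∀ i, classProb P i = 1 / (C : ℝ)) (f : W → X → EuclideanSpace ℝ (Fin d))
    (H : Set (Classifier C d W)) (K δ : ℝ) {S : Fin N → X × Fin C} (hS : IsBalanced S)
    (θ : Classifier C d W) {γ : Fin C → Fin C → ℝ} (hγ : IsMarginFamily γ) :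
    multiclassMarginBound P f H K δ S θ γ = balancedMarginBound P f H K δ S θ γ := by
  have hC0 : (0 : ℝ) < C := by positivity
  have hN0 : (0 : ℝ) < N := by exact_mod_cast hN
  have hcount := hS.classCount_eq (by omega) hCN
  have hcast : ((N / C : ℕ) : ℝ) = N / C := Nat.cast_div hCN hC0.ne'
  have hp' : classProb P = fun _ => 1 / (C : ℝ) := funext hp
  simp only [multiclassMarginBound, balancedMarginBound, hcount, hp', hcast]
  congr 1
  · congr 1
    congr 1
    · rw [ENNReal.ofReal_sum_of_nonneg fun i _ => Finset.sum_nonneg fun j hj =>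
        one_div_nonneg.2 (hγ i j (Finset.ne_of_mem_erase hj).symm).le, Finset.mul_sum]
      refine Finset.sum_congr rfl fun i _ => ?_
      rw [ENNReal.ofReal_sum_of_nonneg fun j hj =>
        one_div_nonneg.2 (hγ i j (Finset.ne_of_mem_erase hj).symm).le, Finset.mul_sum,
        Finset.mul_sum]
      refine Finset.sum_congr rfl fun j hj => ?_
      rw [one_div, one_div, ENNReal.ofReal_inv_of_pos hC0, ENNReal.ofReal_natCast,
        ENNReal.ofReal_inv_of_pos (hγ i j (Finset.ne_of_mem_erase hj).symm), div_eq_mul_inv,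
        div_eq_mul_inv]
      ring
    · congr 1
      rw [Finset.mul_sum]
      refine Finset.sum_congr rfl fun i _ => ?_
      rw [Finset.mul_sum, Finset.mul_sum]
      refine Finset.sum_congr rfl fun j hj => ?_
      -- The identity is `(1/C) √(ℓC/N) = √ℓ / √(NC)`.
      rw [div_div_eq_mul_div, Real.sqrt_div' _ hN0.le, Real.sqrt_mul' _ hC0.le,
        Real.sqrt_mul' _ hC0.le]
      have h1 : Real.sqrt C ≠ 0 := (Real.sqrt_pos.2 hC0).ne'
      have h2 : Real.sqrt N ≠ 0 := (Real.sqrt_pos.2 hN0).ne'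
      field_simp
      rw [Real.sq_sqrt hC0.le, mul_comm]
  · congr 1
    rw [← Finset.mul_sum, sum_sum_erase_const, ← mul_assoc, ← mul_assoc,
      one_div_mul_cancel hC0.ne', one_mul]
    congr 2
    field_simp

/-! ### From class bounds to the error probability. -/

theorem isProbabilityMeasure_classCond {X : Type*} [MeasurableSpace X] {C : ℕ}
    {P : Measure (X × Fin C)} [IsProbabilityMeasure P] {i : Fin C} (hi : P {z | z.2 = i} ≠ 0) :
    IsProbabilityMeasure (classCond P i) := by
  have := cond_isProbabilityMeasure hi
  exact Measure.isProbabilityMeasure_map measurable_fst.aemeasurable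

/-- The error probability is at most the sum over the pairs of classes of the probabilities that
the margin between them is not positive. -/
theorem measureReal_errorEvent_le {X W : Type*} [MeasurableSpace X] {C d : ℕ}
    (P : Measure (X × Fin C)) [IsProbabilityMeasure P] (f : W → X → EuclideanSpace ℝ (Fin d))
    (θ : Classifier C d W) (hm : ∀ i j, i ≠ j → Measurable (margin f θ i j)) :
    P.real (errorEvent f θ) ≤ ∑ i, classProb P i * ∑ j ∈ Finset.univ.erase i,
      (classCond P i).real {x | margin f θ i j x ≤ 0} := by
  have hsub : errorEvent f θ ⊆ ⋃ i ∈ Finset.univ, ⋃ j ∈ Finset.univ.erase i,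
      ({z : X × Fin C | z.2 = i} ∩ Prod.fst ⁻¹' {x | margin f θ i j x ≤ 0}) := by
    rintro z ⟨j, hj, hle⟩
    simp only [Set.mem_iUnion]
    refine ⟨z.2, Finset.mem_univ _, j, Finset.mem_erase.2 ⟨hj, Finset.mem_univ _⟩, rfl, ?_⟩
    change inner ℝ (θ.1 z.2 - θ.1 j) (f θ.2 z.1) ≤ 0
    rw [inner_sub_left]
    exact sub_nonpos.2 hle
  refine (measureReal_mono hsub (measure_ne_top _ _)).trans ((measureReal_biUnion_finset_le _ _).trans ?_)
  refine Finset.sum_le_sum fun i _ => (measureReal_biUnion_finset_le _ _).trans (le_of_eq ?_)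
  rw [Finset.mul_sum]
  refine Finset.sum_congr rfl fun j hj => ?_
  have hs : MeasurableSet {x | margin f θ i j x ≤ 0} :=
    measurableSet_le (hm i j (Finset.ne_of_mem_erase hj).symm) measurable_const
  rw [classCond, map_measureReal_apply measurable_fst hs, classProb, Measure.real, Measure.real,
    Measure.real, ← ENNReal.toReal_mul, mul_comm, cond_mul_eq_inter (measurableSet_snd_eq i)]

/-- Reindexing by `e i` presents the samples of class `i` as an `n`-tuple, the form in which the
one-class bound is stated. -/
theorem empiricalRisk_const_eq {X W : Type*} {C d N n : ℕ} (p : ℝ)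
    (f : W → X → EuclideanSpace ℝ (Fin d)) {S : Fin N → X × Fin C} (θ : Classifier C d W)
    (γ : Fin C → Fin C → ℝ) (hn : ∀ i, classCount S i = n) (e : Fin C → Fin n ↪ Fin N)
    (he : ∀ i, Finset.univ.map (e i) = Finset.univ.filter fun k => (S k).2 = i) :
    empiricalRisk (fun _ => p) f S θ γ = p * ∑ i, ∑ j ∈ Finset.univ.erase i,
      ∑ k : Fin n, (if margin f θ i j (S (e i k)).1 ≤ γ i j then (1 : ℝ) else 0) / n := by
  rw [empiricalRisk, Finset.mul_sum]
  refine Finset.sum_congr rfl fun i _ => ?_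
  congr 1
  refine Finset.sum_congr rfl fun j _ => ?_
  rw [← he i, Finset.sum_map, hn i]

/-- The balanced bound follows from the margin bounds for the pairs of classes. -/
theorem errorEvent_le_balancedMarginBound {X W : Type*} [MeasurableSpace X] {C d N : ℕ}
    (hC : 2 ≤ C) (hN : 0 < N) (hCN : C ∣ N) {P : Measure (X × Fin C)} [IsProbabilityMeasure P]
    (hp : ∀ i, classProb P i = 1 / (C : ℝ)) (f : W → X → EuclideanSpace ℝ (Fin d))
    {H : Set (Classifier C d W)} (hm : ∀ g ∈ marginClass f H, Measurable g) {K δ R : ℝ}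
    (hR0 : 0 ≤ R) (hR : classRademacher (marginClass f H) P (N / C) = ENNReal.ofReal R)
    {S : Fin N → X × Fin C} (hS : IsBalanced S) (e : Fin C → Fin (N / C) ↪ Fin N)
    (he : ∀ i, Finset.univ.map (e i) = Finset.univ.filter fun k => (S k).2 = i)
    {θ : Classifier C d W} (hθ : θ ∈ H) {γ : Fin C → Fin C → ℝ} (hγ : IsMarginFamily γ)
    (hb : ∀ i j, i ≠ j → (classCond P i).real {x | margin f θ i j x ≤ 0} ≤
      4 * R / γ i j + Real.sqrt (logLogTerm K (γ i j) / (N / C : ℕ))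
        + (∑ k : Fin (N / C), (if margin f θ i j (S (e i k)).1 ≤ γ i j then (1 : ℝ) else 0)
          / (N / C : ℕ))
        + Real.sqrt (Real.log ((C : ℝ) * (C - 1) / δ) / (2 * (N / C : ℕ)))) :
    P (errorEvent f θ) ≤ balancedMarginBound P f H K δ S θ γ := by
  have hC0 : (0 : ℝ) < C := by positivity
  have hcount := hS.classCount_eq (by omega) hCN
  have herr := measureReal_errorEvent_le P f θ fun i j hij => hm _ ⟨θ, hθ, i, j, hij, rfl⟩
  have hbound : P.real (errorEvent f θ) ≤
      (∑ i, classProb P i * ∑ j ∈ Finset.univ.erase i, 4 * R / γ i j)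
      + (∑ i, classProb P i * ∑ j ∈ Finset.univ.erase i,
        Real.sqrt (logLogTerm K (γ i j) / classCount S i))
      + empiricalRisk (classProb P) f S θ γ
      + ∑ i, classProb P i * ∑ _j ∈ Finset.univ.erase i,
        Real.sqrt (Real.log ((C : ℝ) * (C - 1) / δ) / (2 * classCount S i)) := by
    rw [show classProb P = fun _ => 1 / (C : ℝ) from funext hp] at herr ⊢
    rw [empiricalRisk_const_eq _ f θ γ hcount e he, Finset.mul_sum, ← Finset.sum_add_distrib,
      ← Finset.sum_add_distrib, ← Finset.sum_add_distrib]
    refine herr.trans (Finset.sum_le_sum fun i _ => ?_)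
    rw [← mul_add, ← mul_add, ← mul_add, ← Finset.sum_add_distrib, ← Finset.sum_add_distrib,
      ← Finset.sum_add_distrib, hcount]
    refine mul_le_mul_of_nonneg_left (Finset.sum_le_sum fun j hj => ?_) (by positivity)
    exact hb i j (Finset.ne_of_mem_erase hj).symm
  rw [← hS.multiclassMarginBound_eq hC hN hCN hp f H K δ θ hγ, ← ofReal_measureReal]
  refine (ENNReal.ofReal_le_ofReal hbound).trans ?_
  refine ENNReal.ofReal_add_le.trans (add_le_add_left ?_ _)
  refine ENNReal.ofReal_add_le.trans (add_le_add_left ?_ _)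
  refine ENNReal.ofReal_add_le.trans (add_le_add_left (le_of_eq ?_) _)
  have hpos : ∀ i, ∀ j ∈ Finset.univ.erase i, 0 < γ i j := fun i j hj =>
    hγ i j (Finset.ne_of_mem_erase hj).symm
  have hpp : ∀ i, 0 ≤ classProb P i := fun i => measureReal_nonneg
  rw [ENNReal.ofReal_sum_of_nonneg fun i _ => mul_nonneg (hpp i) (Finset.sum_nonneg fun j hj =>
    div_nonneg (by positivity) (hpos i j hj).le)]
  refine Finset.sum_congr rfl fun i _ => ?_
  rw [ENNReal.ofReal_mul (hpp i), ENNReal.ofReal_sum_of_nonneg fun j hj =>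
    div_nonneg (by positivity) (hpos i j hj).le]
  congr 1
  refine Finset.sum_congr rfl fun j hj => ?_
  rw [ENNReal.ofReal_div_of_pos (hpos i j hj), ENNReal.ofReal_mul (by norm_num), hcount, hR,
    ENNReal.ofReal_ofNat]

/-- An infinite complexity makes the balanced bound infinite. -/
theorem balancedMarginBound_eq_top {X W : Type*} [MeasurableSpace X] {C d N : ℕ}
    (hC : 2 ≤ C) {P : Measure (X × Fin C)} (f : W → X → EuclideanSpace ℝ (Fin d))
    {H : Set (Classifier C d W)} (K δ : ℝ)
    (hR : classRademacher (marginClass f H) P (N / C) = ⊤) (S : Fin N → X × Fin C)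
    (θ : Classifier C d W) {γ : Fin C → Fin C → ℝ} (hγ : IsMarginFamily γ) :
    balancedMarginBound P f H K δ S θ γ = ⊤ := by
  -- The sum must be nonzero because `⊤ * 0 = 0` in `ℝ≥0∞`.
  have h1 : ENNReal.ofReal (∑ i, ∑ j ∈ Finset.univ.erase i, 1 / γ i j) ≠ 0 := by
    rw [Ne, ENNReal.ofReal_eq_zero, not_le]
    exact hγ.sumInvMargin_pos hC
  rw [balancedMarginBound, hR, ENNReal.mul_top (by norm_num),
    ENNReal.top_div_of_ne_top (ENNReal.natCast_ne_top C), ENNReal.top_mul h1]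
  simp

/-- The balanced bound fails with conditional probability at most `δ` given a balanced sample. -/
theorem cond_isBalanced_bound_fails_le {X W : Type*} [MeasurableSpace X] {C d N : ℕ}
    (hC : 2 ≤ C) (hN : 0 < N) (hCN : C ∣ N) (P : Measure (X × Fin C)) [IsProbabilityMeasure P]
    (hp : ∀ i, classProb P i = 1 / (C : ℝ)) (f : W → X → EuclideanSpace ℝ (Fin d))
    (H : Set (Classifier C d W)) (hF : PointwiseMeasurable (marginClass f H))
    (supp : Fin C → Set X) (hsupp : ∀ᵐ z ∂P, z.1 ∈ supp z.2) (K : ℝ)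
    (hK : ∀ i j, i ≠ j → ∀ θ ∈ H, ∀ x ∈ supp i, |margin f θ i j x| ≤ K)
    (δ : ℝ) (hδ0 : 0 < δ) (hδ1 : δ < 1) :
    (Measure.pi fun _ : Fin N => P)[|{S | IsBalanced S}]
        {S | ¬ ∀ θ ∈ H, ∀ γ : Fin C → Fin C → ℝ, IsMarginFamily γ →
          P (errorEvent f θ) ≤ balancedMarginBound P f H K δ S θ γ} ≤ ENNReal.ofReal δ := by
  classical
  have hC2 : (2 : ℝ) ≤ C := by exact_mod_cast hC
  have hC0 : (0 : ℝ) < C := by linarith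
  set n := N / C with hn_def
  have hn : 0 < n := Nat.div_pos (Nat.le_of_dvd hN hCN) (by omega)
  have hn' : (0 : ℝ) < n := by exact_mod_cast hn
  have hp0 : ∀ i, P {z | z.2 = i} ≠ 0 := fun i h => by
    have := hp i
    rw [classProb, Measure.real, h, ENNReal.toReal_zero] at this
    exact (one_div_pos.2 hC0).ne this
  have hD : ∀ i, IsProbabilityMeasure (classCond P i) :=
    fun i => isProbabilityMeasure_classCond (hp0 i)
  by_cases htop : classRademacher (marginClass f H) P n = ⊤
  · refine le_trans (le_of_eq ?_) zero_le
    convert measure_empty (μ := (Measure.pi fun _ : Fin N => P)[|{S | IsBalanced S}])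
    rw [Set.eq_empty_iff_forall_notMem]
    refine fun S hS => hS fun θ _ γ hγ => ?_
    rw [balancedMarginBound_eq_top hC f K δ htop S θ hγ]
    exact le_top
  obtain ⟨R, hR0, hR⟩ : ∃ R : ℝ, 0 ≤ R ∧
      classRademacher (marginClass f H) P n = ENNReal.ofReal R :=
    ⟨_, ENNReal.toReal_nonneg, (ENNReal.ofReal_toReal htop).symm⟩
  have hRi : ∀ i, rademacherComplexity (marginClass f H) (classCond P i) n ≤ ENNReal.ofReal R :=
    fun i => hR ▸ le_iSup (fun i => rademacherComplexity (marginClass f H) (classCond P i) n) i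
  -- the confidence term
  set t := Real.sqrt (Real.log ((C : ℝ) * (C - 1) / δ) / (2 * n)) with ht
  have hCC : (2 : ℝ) ≤ C * (C - 1) := by nlinarith
  have ht2 : Real.exp (-2 * n * t ^ 2) = δ / (C * (C - 1)) := by
    have h0 : 0 ≤ Real.log ((C : ℝ) * (C - 1) / δ) :=
      Real.log_nonneg ((one_le_div hδ0).2 (by linarith))
    rw [ht, Real.sq_sqrt (by positivity), show -2 * (n : ℝ) *
      (Real.log ((C : ℝ) * (C - 1) / δ) / (2 * n)) = -Real.log ((C : ℝ) * (C - 1) / δ) by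
        field_simp, Real.exp_neg, Real.exp_log (div_pos (by linarith) hδ0), inv_div]
  -- The event for class `i` ranges over the whole margin class, hence serves all `j` at once: `C`
  -- events suffice.
  set B : Fin C → Set (Fin n → X) := fun i => {x | ∃ g ∈ marginClass f H, ∃ γ, 0 < γ ∧ γ < K ∧
    4 * R / γ + Real.sqrt (logLogTerm K γ / n)
      + (∑ k : Fin n, (if g (x k) ≤ γ then (1 : ℝ) else 0) / n) + t <
    (classCond P i).real {a | g a ≤ 0}} with hB
  have hBle : ∀ i, Measure.pi (fun _ => classCond P i) (B i) ≤
      ENNReal.ofReal (δ / (C * (C - 1))) := fun i => by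
    rw [← ht2]
    convert hF.measure_margin_bound_fails_le (classCond P i) hn hR0 (hRi i) K
      (Real.sqrt_nonneg _) using 2
  -- conditioning on the labels
  have hlab : {S : Fin N → X × Fin C | IsBalanced S} =
      {S | (fun k => (S k).2) ∈ {l : Fin N → Fin C |
        ∀ i, ((Finset.univ.filter fun k => l k = i).card : ℝ) = (N : ℝ) / C}} := rfl
  have hbox : ∀ l : Fin N → Fin C, {S : Fin N → X × Fin C | (fun k => (S k).2) = l} =
      Set.univ.pi fun k => {z : X × Fin C | z.2 = l k} := fun l => by
    ext S; simp [funext_iff]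
  rw [hlab]
  refine cond_preimage_le _ _ (fun l => ?_) _ _ _ fun l hl => ?_
  · rw [hbox]; exact MeasurableSet.univ_pi fun k => measurableSet_snd_eq _
  have hcard : ∀ i, (Finset.univ.filter fun k => l k = i).card = n := fun i => by
    have := hl i
    rw [← Nat.cast_div hCN hC0.ne'] at this
    exact_mod_cast this
  -- The increasing enumeration of the positions labelled `i` depends on `l` alone, so it is
  -- deterministic once the labels are fixed.
  set e : Fin C → Fin n ↪ Fin N :=
    fun i => ((Finset.univ.filter fun k => l k = i).orderEmbOfFin (hcard i)).toEmbedding with he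
  have hemap : ∀ i, Finset.univ.map (e i) = Finset.univ.filter fun k => l k = i :=
    fun i => Finset.map_orderEmbOfFin_univ _ _
  have hel : ∀ i k, l (e i k) = i := fun i k => by
    have : e i k ∈ Finset.univ.map (e i) := Finset.mem_map_of_mem _ (Finset.mem_univ k)
    rw [hemap] at this
    simpa using this
  have hmem := ae_cond_mem (μ := Measure.pi fun _ : Fin N => P)
    (s := {S : Fin N → X × Fin C | (fun k => (S k).2) = l})
    (by rw [hbox]; exact MeasurableSet.univ_pi fun k => measurableSet_snd_eq _)
  have hsuppS : ∀ᵐ S ∂(Measure.pi fun _ : Fin N => P)[|{S : Fin N → X × Fin C |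
      (fun k => (S k).2) = l}], ∀ k, (S k).1 ∈ supp (S k).2 := by
    refine cond_absolutelyContinuous.ae_le (ae_all_iff.2 fun k => ?_)
    exact (measurePreserving_eval (fun _ : Fin N => P) k).quasiMeasurePreserving.ae hsupp
  calc _ ≤ (Measure.pi fun _ : Fin N => P)[|{S : Fin N → X × Fin C | (fun k => (S k).2) = l}]
        (⋃ i, (fun S k => (S (e i k)).1) ⁻¹' B i) := by
        refine measure_mono_ae ?_
        filter_upwards [hmem, hsuppS] with S hSl hSs hfail
        by_contra hgood
        refine hfail fun θ hθ γ hγ => ?_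
        have hSl' : ∀ k, (S k).2 = l k := fun k => congrFun hSl k
        have hSb : IsBalanced S := fun i => by
          have := hl i
          simpa only [classCount, hSl'] using this
        refine errorEvent_le_balancedMarginBound hC hN hCN hp f hF.1 hR0 hR hSb e
          (fun i => by simpa only [hSl'] using hemap i) hθ hγ fun i j hij => ?_
        have hγ0 := hγ i j hij
        -- For `γ i j ≥ K` every sampled margin of class `i` is almost surely at most `γ i j`, so
        -- the empirical term alone is `1`.
        rcases lt_or_ge (γ i j) K with hγK | hγK
        · by_contra hlt
          exact hgood (Set.mem_iUnion.2 ⟨i, _, ⟨θ, hθ, i, j, hij, rfl⟩, γ i j, hγ0, hγK,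
            not_le.1 hlt⟩)
        · have hone : ∑ k : Fin n, (if margin f θ i j (S (e i k)).1 ≤ γ i j then (1 : ℝ) else 0) /
              n = 1 := by
            have : ∀ k : Fin n, margin f θ i j (S (e i k)).1 ≤ γ i j := fun k => by
              have h1 := hSs (e i k)
              rw [hSl', hel] at h1
              exact ((le_abs_self _).trans (hK i j hij θ hθ _ h1)).trans hγK
            simp only [this, if_true, Finset.sum_const, Finset.card_univ, Fintype.card_fin,
              nsmul_eq_mul]
            field_simp
          have h1 : (classCond P i).real {x | margin f θ i j x ≤ 0} ≤ 1 := measureReal_le_one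
          have h2 : 0 ≤ 4 * R / γ i j := by positivity
          have h3 := Real.sqrt_nonneg (logLogTerm K (γ i j) / n)
          have h4 : 0 ≤ t := Real.sqrt_nonneg _
          linarith
    _ ≤ ∑ i : Fin C, ENNReal.ofReal (δ / (C * (C - 1))) := by
        refine (measure_iUnion_fintype_le _ _).trans (Finset.sum_le_sum fun i _ => ?_)
        refine le_trans ?_ (hBle i)
        rw [hbox, cond_pi P _ fun k => measurableSet_snd_eq _,
          ← map_fst_comp_pi_cond P hp0 l i (e i) (hel i)]
        -- This direction holds for arbitrary sets; `B i`, with its uncountable quantifiers, need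
        -- not be measurable.
        refine Measure.le_map_apply (Measurable.aemeasurable ?_) _
        fun_prop
    _ ≤ ENNReal.ofReal δ := by
        rw [Finset.sum_const, Finset.card_univ, Fintype.card_fin, ← ENNReal.ofReal_nsmul]
        refine ENNReal.ofReal_le_ofReal ?_
        -- The total is `δ/(C-1)`, at most `δ` since `C ≥ 2`.
        rw [nsmul_eq_mul, ← mul_div_assoc, mul_div_mul_left _ _ hC0.ne']
        exact div_le_self hδ0.le (by linarith)

theorem mainTheorem5 {X W : Type*} [MeasurableSpace X] {C d N : ℕ}
    (hC : 2 ≤ C) (hN : 0 < N) (hCN : C ∣ N)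
    (P : Measure (X × Fin C)) [IsProbabilityMeasure P]
    (hp : ∀ i, classProb P i = 1 / (C : ℝ))
    (f : W → X → EuclideanSpace ℝ (Fin d)) (H : Set (Classifier C d W))
    (hF : PointwiseMeasurable (marginClass f H))
    (supp : Fin C → Set X) (hsupp : ∀ᵐ z ∂P, z.1 ∈ supp z.2)
    (K : ℝ)
    (hK : ∀ i j, i ≠ j → ∀ θ ∈ H, ∀ x ∈ supp i, |margin f θ i j x| ≤ K)
    (δ : ℝ) (hδ0 : 0 < δ) (hδ1 : δ < 1) :
    -- with conditional probability at least `1 - δ` given a balanced training set, the balanced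
    -- bound holds simultaneously for all classifiers and all margins
    (Measure.pi fun _ : Fin N => P)[|{S | IsBalanced S}]
        {S | ¬ ∀ θ ∈ H, ∀ γ : Fin C → Fin C → ℝ, IsMarginFamily γ →
          P (errorEvent f θ) ≤ balancedMarginBound P f H K δ S θ γ} ≤ ENNReal.ofReal δ ∧
    -- on a balanced training set the general bound is the balanced bound
    (∀ S : Fin N → X × Fin C, IsBalanced S → ∀ θ ∈ H, ∀ γ : Fin C → Fin C → ℝ, IsMarginFamily γ →
      multiclassMarginBound P f H K δ S θ γ = balancedMarginBound P f H K δ S θ γ) ∧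
    -- the sum of inverse margins is controlled by the minimal margin
    (∀ γ : Fin C → Fin C → ℝ, IsMarginFamily γ →
      sumInvMargin γ ≤ (C : ℝ) * (C - 1) * maxInvMargin γ ∧
      maxInvMargin γ = 1 / minMargin γ) ∧
    -- the same after minimising over any set of margin families
    (∀ Γ : Set (Fin C → Fin C → ℝ), Γ.Nonempty → (∀ γ ∈ Γ, IsMarginFamily γ) →
      1 / ((C : ℝ) * (C - 1)) * sInf (sumInvMargin '' Γ) ≤ sInf (maxInvMargin '' Γ) ∧
      ∀ γ ∈ Γ, IsMinOn maxInvMargin Γ γ ↔ IsMaxOn minMargin Γ γ) := by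
  exact ⟨cond_isBalanced_bound_fails_le hC hN hCN P hp f H hF supp hsupp K hK δ hδ0 hδ1,
    fun _ hS θ _ _ hγ => hS.multiclassMarginBound_eq hC hN hCN hp f H K δ θ hγ,
    fun γ hγ => ⟨sumInvMargin_le γ, hγ.maxInvMargin_eq hC⟩,
    fun _ hne hΓ => ⟨sInf_sumInvMargin_le hC hne hΓ,
      fun _ hγ => isMinOn_maxInvMargin_iff hC hΓ hγ⟩⟩
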